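/- Let $(\Sigma,g)$ be an oriented smooth Riemannian $3$-manifold and let $\mathcal P\to\Sigma$ be the $\mathrm{SO}(3)$-bundle of oriented orthonormal frames $B=(B_1,B_2,B_3)$. Let $\phi={}^t(\phi^1,\phi^2,\phi^3)$ be the canonical $1$-form on $\mathcal P$, $\phi^i(v)=g(B_i,\pi_*v)$ at $(p,B)$ with $\pi\colon\mathcal P\to\Sigma$ the projection, and let $$\omega=\begin{pmatrix}0&\omega^3&-\omega^2\\-\omega^3&0&\omega^1\\ \omega^2&-\omega^1&0\end{pmatrix}$$ be the Levi-Civita connection form of $g$ on $\mathcal P$, $\omega_{ij}=g(B_i,\nabla B_j)$. Let $$G^{\mathrm F}=2\,(\phi^1\cdot\omega^1+\phi^2\cdot\omega^2+\phi^3\cdot\omega^3)$$ be the Fefferman metric on $\mathcal P$, where $\alpha\cdot\beta=\tfrac12(\alpha\otimes\beta+\beta\otimes\alpha)$, and let $K$ be the vector field on $\mathcal P$ generating the circle action $(p,B)\mapsto(p,B\,e^{sY})$, with $Y=\begin{pmatrix}0&1&0\\-1&0&0\\0&0&0\end{pmatrix}$, which rotates the first two frame vectors. Let $x(t)$, $a\le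 t\le b$ ($a<b$), be a smooth regular curve on $\Sigma$ and let $\gamma(t)=(x(t),B(t))$, $a\le t\le b$, be a smooth curve on $\mathcal P$ which projects to the tangent lift $\tilde x(t)=(x(t),\dot x(t)/|\dot x(t)|)$ in the unit tangent sphere bundle, i.e. $B_3(t)=\dot x(t)/|\dot x(t)|$. Let $\gamma_\epsilon(t)$, $|\epsilon|<\delta$, $a\le t\le b$, be a smooth variation of $\gamma=\gamma_0$ through curves on $\mathcal P$ fixing the endpoints, $\gamma_\epsilon(a)=\gamma(a)$ and $\gamma_\epsilon(b)=\gamma(b)$, such that the variation vector field $(\partial/\partial\epsilon)|_{\epsilon=0}\gamma_\epsilon(t)$ is vertical with respect to $\mathcal P\to\Sigma$ for every $t\in[a,b]$. Then, for all sufficiently small $|\epsilon|$, the function $G^{\mathrm F}(K,\dot\gamma_\epsilon(t))$ has no zero on $[a,b]$ and the integral below is well defined; it is differentiable in $\epsilon$ at $\epsilon=0$, and $$\frac{\mathrm d}{\mathrm d\epsilon}\Big|_{\epsilon=0}\int_a^b\frac{G^{\mathrm F}(\dot\gamma_\epsilon(t),\dot\gamma_\epsilon(t))}{G^{\mathrm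 F}(K,\dot\gamma_\epsilon(t))}\,\mathrm dt=0.$$ -/

import Mathlib

open Set Filter Topology Bundle MeasureTheory
open scoped Manifold ContDiff

noncomputable section

namespace FeffermanFrame

/-- The coordinate space `ℝ³`. -/
abbrev R3 : Type := Fin 3 → ℝ

/-- The standard basis vectors of `ℝ³` (indices `0, 1, 2`). -/
def stdVec (i : Fin 3) : R3 := Pi.single i 1

section Bundles

variable {E : Type*} [NormedAddCommGroup E] [NormedSpace ℝ E]
variable {M : Type*} [TopologicalSpace M] [ChartedSpace E M] [IsManifold 𝓘(ℝ, E) ∞ M]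

variable (E M) in
/-- The total space of the smooth vector bundle `Hom(ℝ³, TM)` over `M`. A point is a pair
`(p, B)` with `B : ℝ³ → T_p M` linear, that is, a triple of tangent vectors
`B e₀, B e₁, B e₂` at `p`. The frame bundle is an embedded submanifold of it. -/
abbrev TripleBundle : Type _ :=
  TotalSpace (R3 →L[ℝ] E)
    (fun p : M => Bundle.Trivial M R3 p →L[ℝ] TangentSpace 𝓘(ℝ, E) p)

variable (E) in
/-- The model with corners of `TripleBundle E M`. -/
abbrev tripleModel : ModelWithCorners ℝ (E × (R3 →L[ℝ] E)) (ModelProd E (R3 →L[ℝ] E)) :=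
  𝓘(ℝ, E).prod 𝓘(ℝ, R3 →L[ℝ] E)

/-- The `i`-th vector of the triple `u = (p, B)`. -/
def frameVec (u : TripleBundle E M) (i : Fin 3) : TangentSpace 𝓘(ℝ, E) u.proj :=
  u.snd (stdVec i)

/-- The triple `u` is a basis of the tangent space which is positively oriented with respect to
the pointwise choice of orientations `o`. -/
def IsPositiveFrame (o : ∀ p : M, Orientation ℝ (TangentSpace 𝓘(ℝ, E) p) (Fin 3))
    (u : TripleBundle E M) : Prop :=
  ∃ b : Module.Basis (Fin 3) ℝ (TangentSpace 𝓘(ℝ, E) u.proj),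
    (∀ i, b i = frameVec u i) ∧ b.orientation = o u.proj

variable (E M) in
/-- An orientation of the 3-manifold `M`: an orientation of every tangent space, depending
continuously on the point, i.e. the positively oriented frames form an open set. -/
structure ManifoldOrientation where
  /-- the orientation of the tangent space at a point -/
  orientationAt : ∀ p : M, Orientation ℝ (TangentSpace 𝓘(ℝ, E) p) (Fin 3)
  isOpen_positive : IsOpen {u : TripleBundle E M | IsPositiveFrame orientationAt u}

variable (E M) in
/-- The smooth Riemannian metrics on `M`. -/
abbrev SmoothMetric : Type _ :=
  ContMDiffRiemannianMetric 𝓘(ℝ, E) ∞ E (fun p : M => TangentSpace 𝓘(ℝ, E) p)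

/-- The bundle `𝒫` of oriented orthonormal frames of `(M, g)`. -/
def frameBundle (g : SmoothMetric E M) (o : ManifoldOrientation E M) : Set (TripleBundle E M) :=
  {u | (∀ i j, g.inner u.proj (frameVec u i) (frameVec u j) = if i = j then 1 else 0) ∧
    IsPositiveFrame o.orientationAt u}

/-- The derivative `π_*` at `u` of the projection `π (p, B) = p`. -/
def projDeriv (u : TripleBundle E M) :
    TangentSpace (tripleModel E) u →L[ℝ] TangentSpace 𝓘(ℝ, E) u.proj :=
  mfderiv (tripleModel E) 𝓘(ℝ, E) (fun w : TripleBundle E M => w.proj) u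

/-- The components `φ⁰, φ¹, φ²` of the canonical 1-form, `φ(v) = B⁻¹ (π_* v)`; at an orthonormal
frame these are the inner products of `π_* v` with the frame vectors. -/
def canonicalForm (g : SmoothMetric E M) (u : TripleBundle E M) (v : TangentSpace (tripleModel E) u)
    (i : Fin 3) : ℝ :=
  g.inner u.proj (frameVec u i) (projDeriv u v)

/-- The metric `g` in the preferred chart at `q`: its value at the point with coordinates `y`
on the coordinate vectors `a`, `b`. -/
def coordMetric (g : SmoothMetric E M) (q : M) (y a b : E) : ℝ :=
  g.inner ((extChartAt 𝓘(ℝ, E) q).symm y)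
    (mfderiv 𝓘(ℝ, E) 𝓘(ℝ, E) (extChartAt 𝓘(ℝ, E) q).symm y a)
    (mfderiv 𝓘(ℝ, E) 𝓘(ℝ, E) (extChartAt 𝓘(ℝ, E) q).symm y b)

/-- The Christoffel symbols of the first kind of `g` in the preferred chart at `q`, as a
trilinear expression: for constant coordinate fields `a`, `b`, `c` this is `g(∇_a b, c)` with `∇`
the Levi-Civita connection,
`(∂_a g(b, c) + ∂_b g(a, c) - ∂_c g(a, b)) / 2`. -/
def christoffel (g : SmoothMetric E M) (q : M) (y a b c : E) : ℝ :=
  (fderiv ℝ (fun z => coordMetric g q z b c) y a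
    + fderiv ℝ (fun z => coordMetric g q z a c) y b
    - fderiv ℝ (fun z => coordMetric g q z a b) y c) / 2

/-- The components in the preferred chart of `TripleBundle E M` at `u` of a tangent vector at
`u`: the first component is the velocity of the base point, the second one the velocity of the
coordinates of the triple. -/
def coordVector (u : TripleBundle E M) (v : TangentSpace (tripleModel E) u) :
    E × (R3 →L[ℝ] E) :=
  mfderiv (tripleModel E) 𝓘(ℝ, E × (R3 →L[ℝ] E)) (extChartAt (tripleModel E) u) u v

/-- The entry `ω_{ij}` of the Levi-Civita connection form `ω = B⁻¹ ∇B`. At an orthonormal frame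
`B = (B₀, B₁, B₂)` it is `ω_{ij}(v) = g(B_i, ∇_v B_j)`, where in coordinates
`∇_v B_j = Ḃ_j + Γ(ẋ, B_j)` for `v = (ẋ, Ḃ)`. On vectors tangent to the orthonormal frame bundle
the matrix is skew-symmetric. -/
def connectionForm (g : SmoothMetric E M) (u : TripleBundle E M) (v : TangentSpace (tripleModel E) u)
    (i j : Fin 3) : ℝ :=
  let y : E := (extChartAt (tripleModel E) u u).1
  let B : R3 →L[ℝ] E := (extChartAt (tripleModel E) u u).2
  let w := coordVector u v
  coordMetric g u.proj y (B (stdVec i)) (w.2 (stdVec j))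
    + christoffel g u.proj y w.1 (B (stdVec j)) (B (stdVec i))

/-- The components `ω¹, ω², ω³` (here indexed by `0, 1, 2`) of the `𝔰𝔬(3)`-valued form `ω`, with
the convention that `ω` is the matrix with rows `(0, ω³, -ω²)`, `(-ω³, 0, ω¹)`, `(ω², -ω¹, 0)`. -/
def connectionComp (g : SmoothMetric E M) (u : TripleBundle E M) (v : TangentSpace (tripleModel E) u) :
    Fin 3 → ℝ :=
  ![connectionForm g u v 1 2, connectionForm g u v 2 0, connectionForm g u v 0 1]

/-- The Fefferman metric `G = 2 (φ¹·ω¹ + φ²·ω² + φ³·ω³)` on the frame bundle, where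
`α·β = (α ⊗ β + β ⊗ α) / 2` is the symmetric product. -/
def feffermanMetric (g : SmoothMetric E M) (u : TripleBundle E M)
    (v w : TangentSpace (tripleModel E) u) : ℝ :=
  ∑ i, (canonicalForm g u v i * connectionComp g u w i
    + canonicalForm g u w i * connectionComp g u v i)

/-- The right action `(p, B) ↦ (p, B A)` of a 3×3 matrix `A`. -/
def rightAct (u : TripleBundle E M) (A : Matrix (Fin 3) (Fin 3) ℝ) : TripleBundle E M :=
  ⟨u.proj, ContinuousLinearMap.comp (M₁ := R3) u.snd
    (LinearMap.toContinuousLinearMap (Matrix.toLin' A))⟩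

/-- The one-parameter group `exp(sY)` in `SO(3)`, where `Y` is the matrix with rows `(0, 1, 0)`,
`(-1, 0, 0)`, `(0, 0, 0)`. -/
def rotation (s : ℝ) : Matrix (Fin 3) (Fin 3) ℝ :=
  !![Real.cos s, Real.sin s, 0; -Real.sin s, Real.cos s, 0; 0, 0, 1]

/-- The flow `s ↦ u · exp(sY)` of the circle action, which rotates the first two frame vectors. -/
def circleFlow (u : TripleBundle E M) (s : ℝ) : TripleBundle E M :=
  rightAct u (rotation s)

theorem circleFlow_zero (u : TripleBundle E M) : circleFlow u 0 = u := by
  have h : rotation 0 = 1 := by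
    ext i j
    fin_cases i <;> fin_cases j <;> simp [rotation]
  rw [circleFlow, h, rightAct, Matrix.toLin'_one]
  rfl

/-- The infinitesimal generator `K` of the circle action on the frame bundle: the velocity at
`s = 0` of the flow (which is at `u` at that time). -/
def circleField (u : TripleBundle E M) : TangentSpace (tripleModel E) u :=
  circleFlow_zero u ▸ mfderiv 𝓘(ℝ, ℝ) (tripleModel E) (circleFlow u) 0 (1 : ℝ)

/-- The velocity at time `t` of a curve in the bundle defined on `[a, b]`. -/
def frameVelocity (a b : ℝ) (γ : ℝ → TripleBundle E M) (t : ℝ) :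
    TangentSpace (tripleModel E) (γ t) :=
  mfderivWithin 𝓘(ℝ, ℝ) (tripleModel E) γ (Icc a b) t (1 : ℝ)

variable (E) in
/-- The velocity at time `t` of a curve in `M` defined on `[a, b]`. -/
def baseVelocity (a b : ℝ) (x : ℝ → M) (t : ℝ) : TangentSpace 𝓘(ℝ, E) (x t) :=
  mfderivWithin 𝓘(ℝ, ℝ) 𝓘(ℝ, E) x (Icc a b) t (1 : ℝ)

variable (E) in
/-- A regular curve `x(t)`, `a ≤ t ≤ b`: smooth with nowhere vanishing velocity. -/
def IsRegularCurve (a b : ℝ) (x : ℝ → M) : Prop :=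
  ContMDiffOn 𝓘(ℝ, ℝ) 𝓘(ℝ, E) ∞ x (Icc a b) ∧ ∀ t ∈ Icc a b, baseVelocity E a b x t ≠ 0

/-- The tangent lift `(x(t), ẋ(t) / |ẋ(t)|)` of a curve to the unit tangent sphere bundle. -/
def tangentLift (g : SmoothMetric E M) (a b : ℝ) (x : ℝ → M) (t : ℝ) : TangentBundle 𝓘(ℝ, E) M :=
  ⟨x t, (√(g.inner (x t) (baseVelocity E a b x t) (baseVelocity E a b x t)))⁻¹ •
    baseVelocity E a b x t⟩

/-- The projection of the frame bundle to the unit tangent sphere bundle: the third vector of the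
frame. -/
def sphereProj (u : TripleBundle E M) : TangentBundle 𝓘(ℝ, E) M :=
  ⟨u.proj, frameVec u 2⟩

/-- `Γ ε t`, for `|ε| < δ` and `a ≤ t ≤ b`, is a smooth variation of `γ` through curves in the
frame bundle, fixing the endpoints. -/
structure IsVariation (g : SmoothMetric E M) (o : ManifoldOrientation E M) (a b δ : ℝ)
    (γ : ℝ → TripleBundle E M) (Γ : ℝ → ℝ → TripleBundle E M) : Prop where
  smooth : ContMDiffOn 𝓘(ℝ, ℝ × ℝ) (tripleModel E) ∞ (fun q : ℝ × ℝ => Γ q.1 q.2)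
    (Ioo (-δ) δ ×ˢ Icc a b)
  mem : ∀ ε ∈ Ioo (-δ) δ, ∀ t ∈ Icc a b, Γ ε t ∈ frameBundle g o
  zero : ∀ t ∈ Icc a b, Γ 0 t = γ t
  left : ∀ ε ∈ Ioo (-δ) δ, Γ ε a = γ a
  right : ∀ ε ∈ Ioo (-δ) δ, Γ ε b = γ b

/-- The variation vector field `∂_ε Γ` at `ε = 0`. -/
def variationField (Γ : ℝ → ℝ → TripleBundle E M) (t : ℝ) : TangentSpace (tripleModel E) (Γ 0 t) :=
  mfderiv 𝓘(ℝ, ℝ) (tripleModel E) (fun ε => Γ ε t) 0 (1 : ℝ)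

/-- The denominator `G(K, γ̇(t))`. -/
def kropinaDenom (g : SmoothMetric E M) (a b : ℝ) (γ : ℝ → TripleBundle E M) (t : ℝ) : ℝ :=
  feffermanMetric g (γ t) (circleField (γ t)) (frameVelocity a b γ t)

/-- The Kropina integrand `G(γ̇(t), γ̇(t)) / G(K, γ̇(t))`. -/
def kropinaIntegrand (g : SmoothMetric E M) (a b : ℝ) (γ : ℝ → TripleBundle E M) (t : ℝ) : ℝ :=
  feffermanMetric g (γ t) (frameVelocity a b γ t) (frameVelocity a b γ t) /
    kropinaDenom g a b γ t

end Bundles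

end FeffermanFrame

end

/-! On the frame bundle `K` is vertical, so φ(K) = 0, and among the connection components only `ω 0
1` is nonzero on `K`, with value 1; hence G(K, v) = φ²(v), indices running over 0, 1, 2. With φ and
ω evaluated on the velocity, the integrand is therefore L = 2 ω₀₁ + 2 (φ⁰ ω₁₂ + φ¹ ω₂₀) / φ². Along
γ the third frame vector is the unit tangent, so φ⁰ = φ¹ = 0 and φ² = f ≠ 0. Nonvanishing of the
denominator for small ε follows from compactness of `[a, b]`.

Let v be the skew matrix of ω on the variation field and W that of ω on the velocity. For a vertical
variation the base point is stationary to first order, so no curvature enters and the structure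
equations give δφⁱ = f v₂ᵢ for i = 0, 1 and δω₀₁ = v₀₁' + [W, v]₀₁ = v₀₁' - v₂₀ W₁₂ - v₂₁ W₂₀. The
variation of φ² drops out because φ⁰ = φ¹ = 0, and the remaining terms cancel: δL = 2 v₀₁'. Since v
vanishes at the fixed endpoints, the integral of δL is zero.

The computation of δL is `exists_hasDerivAt_kropina`, carried out in one chart. Because
`connectionForm` at `u` uses the chart centred at `u`, which moves along a curve, chart independence
must come first; this is `connectionForm_eq`. `hasDerivAt_integral_of_variation_eq_deriv`
differentiates under the integral and applies the fundamental theorem of calculus. -/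

noncomputable section

namespace FeffermanFrame

set_option linter.unusedSectionVars false

variable {E : Type*} [NormedAddCommGroup E] [NormedSpace ℝ E]
variable {M : Type*} [TopologicalSpace M] [ChartedSpace E M] [IsManifold 𝓘(ℝ, E) ∞ M]

/- Shortcuts for instances on bilinear forms that are slow to find. -/
local instance : NormedAddCommGroup (E →L[ℝ] E →L[ℝ] ℝ) := ContinuousLinearMap.toNormedAddCommGroup
local instance : NormedSpace ℝ (E →L[ℝ] E →L[ℝ] ℝ) := ContinuousLinearMap.toNormedSpace
local instance : AddCommGroup (E →L[ℝ] E →L[ℝ] ℝ) := ContinuousLinearMap.addCommGroup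

/-! ### The metric in a chart -/

/-- The metric at a point, as a bilinear form on the model space. -/
def innerModel (g : SmoothMetric E M) (p : M) : E →L[ℝ] E →L[ℝ] ℝ := g.inner p

variable (E) in
/-- The derivative at `p` of the preferred chart at `q`. -/
def chartDeriv (q p : M) : E →L[ℝ] E := mfderiv 𝓘(ℝ, E) 𝓘(ℝ, E) (extChartAt 𝓘(ℝ, E) q) p
/-- The derivative at `y` of the inverse of the preferred chart at `q`. -/
def chartSymmDeriv (q : M) (y : E) : E →L[ℝ] E :=
  mfderiv 𝓘(ℝ, E) 𝓘(ℝ, E) (extChartAt 𝓘(ℝ, E) q).symm y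

/-- The metric in the preferred chart at `q`, as a field of bilinear forms. -/
def metricForm (g : SmoothMetric E M) (q : M) (y : E) : E →L[ℝ] E →L[ℝ] ℝ :=
  (innerModel g ((extChartAt 𝓘(ℝ, E) q).symm y)).bilinearComp (chartSymmDeriv q y)
    (chartSymmDeriv q y)

theorem coordMetric_eq (g : SmoothMetric E M) (q : M) (y a b : E) :
    coordMetric g q y a b = metricForm g q y a b := rfl

theorem chartSymmDeriv_chartDeriv {q p : M} (hp : p ∈ (extChartAt 𝓘(ℝ, E) q).source) (v : E) :
    chartSymmDeriv q (extChartAt 𝓘(ℝ, E) q p) (chartDeriv E q p v) = v := by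
  have h := mfderivWithin_extChartAt_symm_comp_mfderiv_extChartAt' (I := 𝓘(ℝ, E)) hp
  have h2 := DFunLike.congr_fun h v
  have h3 : range 𝓘(ℝ, E) = univ := by simp
  rw [h3, mfderivWithin_univ] at h2
  exact h2

theorem chartDeriv_chartSymmDeriv {q : M} {y : E} (hy : y ∈ (extChartAt 𝓘(ℝ, E) q).target) (v : E) :
    chartDeriv E q ((extChartAt 𝓘(ℝ, E) q).symm y) (chartSymmDeriv q y v) = v := by
  have h := mfderiv_extChartAt_comp_mfderivWithin_extChartAt_symm (I := 𝓘(ℝ, E)) hy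
  have h2 := DFunLike.congr_fun h v
  have h3 : range 𝓘(ℝ, E) = univ := by simp
  rw [h3, mfderivWithin_univ] at h2
  exact h2

theorem metricForm_chartDeriv (g : SmoothMetric E M) {q p : M}
    (hp : p ∈ (extChartAt 𝓘(ℝ, E) q).source) (v w : E) :
    metricForm g q (extChartAt 𝓘(ℝ, E) q p) (chartDeriv E q p v) (chartDeriv E q p w) =
      innerModel g p v w := by
  simp only [metricForm, ContinuousLinearMap.bilinearComp_apply, chartSymmDeriv_chartDeriv hp,
    (extChartAt 𝓘(ℝ, E) q).left_inv hp]

theorem chartSymmDeriv_eq_trivializationAt_symm {q p : M}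
    (hp : p ∈ (extChartAt 𝓘(ℝ, E) q).source) (v : E) :
    chartSymmDeriv q (extChartAt 𝓘(ℝ, E) q p) v =
      (trivializationAt E (TangentSpace 𝓘(ℝ, E)) q).symm p v := by
  have h := TangentBundle.symmL_trivializationAt (I := 𝓘(ℝ, E)) (𝕜 := ℝ) (x₀ := q) (x := p)
    (by simpa using hp)
  have h2 := DFunLike.congr_fun h v
  have h3 : range 𝓘(ℝ, E) = univ := by simp
  rw [h3, mfderivWithin_univ, Trivialization.symmL_apply _ (by simpa using hp)] at h2
  exact h2.symm

/-- Smoothness of `g` is that of a section of a Hom bundle. Its expression in the trivialization at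
`q` is the pull-back by the inverse tangent trivialization, which is the derivative of the inverse
chart. -/
theorem contDiffAt_metricForm (g : SmoothMetric E M) {q : M} {y : E}
    (hy : y ∈ (extChartAt 𝓘(ℝ, E) q).target) :
    ContDiffAt ℝ ∞ (metricForm g q) y := by
  have hs := (extChartAt 𝓘(ℝ, E) q).map_target hy
  have h1 := ((trivializationAt (E →L[ℝ] E →L[ℝ] ℝ) (fun p : M =>
      TangentSpace 𝓘(ℝ, E) p →L[ℝ] TangentSpace 𝓘(ℝ, E) p →L[ℝ] ℝ) q).contMDiffAt_section_iff
      (IB := 𝓘(ℝ, E)) (n := ∞) (s := g.inner) (x₀ := (extChartAt 𝓘(ℝ, E) q).symm y)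
      (by simpa using hs)).1 (g.contMDiff _)
  have h2 := h1.comp y ((contMDiffOn_extChartAt_symm (I := 𝓘(ℝ, E)) (n := ∞) q).contMDiffAt
    ((isOpen_extChartAt_target q).mem_nhds hy))
  rw [contMDiffAt_iff_contDiffAt] at h2
  refine h2.congr_of_eventuallyEq ?_
  filter_upwards [(isOpen_extChartAt_target (I := 𝓘(ℝ, E)) q).mem_nhds hy] with z hz
  have hs := (extChartAt 𝓘(ℝ, E) q).map_target hz
  have hz' := (extChartAt 𝓘(ℝ, E) q).right_inv hz
  have hs' := hs
  rw [extChartAt_source] at hs'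
  ext v w
  simp only [Function.comp_apply, hom_trivializationAt_apply]
  refine Eq.trans ?_ (inCoordinates_apply_eq₂ (F₃ := ℝ) (E₃ := Bundle.Trivial M ℝ)
    (by simpa using hs) (by simpa using hs) (by simp)).symm
  rw [← chartSymmDeriv_eq_trivializationAt_symm hs, ← chartSymmDeriv_eq_trivializationAt_symm hs,
    hz']
  have hid : (trivializationAt ℝ (Bundle.Trivial M ℝ) q).linearMapAt ℝ
      ((extChartAt 𝓘(ℝ, E) q).symm z) = LinearMap.id :=
    Bundle.Trivial.linearMapAt_trivialization ℝ M ℝ _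
  exact (DFunLike.congr_fun hid _).symm

/-! ### Charts of the bundle of triples and transition maps -/

theorem mem_extChartAt_tripleBundle_source {u₀ u : TripleBundle E M} :
    u ∈ (extChartAt (tripleModel E) u₀).source ↔
      u.proj ∈ (extChartAt 𝓘(ℝ, E) u₀.proj).source := by
  rw [extChartAt_source, FiberBundle.chartedSpace_chartAt]
  simp only [mfld_simps]
  have : (trivializationAt (R3 →L[ℝ] E)
      (fun p : M => Bundle.Trivial M R3 p →L[ℝ] TangentSpace 𝓘(ℝ, E) p) u₀.proj u).1 = u.proj := rfl
  rw [this]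
  simp

/-- The factor ℝ³ is trivial, so the chart only pushes the triple forward by the derivative of the
base chart. -/
theorem extChartAt_tripleBundle {u₀ u : TripleBundle E M}
    (hu : u.proj ∈ (extChartAt 𝓘(ℝ, E) u₀.proj).source) :
    extChartAt (tripleModel E) u₀ u = (extChartAt 𝓘(ℝ, E) u₀.proj u.proj,
      (chartDeriv E u₀.proj u.proj).comp (u.snd : R3 →L[ℝ] E)) := by
  have h := TangentBundle.continuousLinearMapAt_trivializationAt (I := 𝓘(ℝ, E)) (𝕜 := ℝ)
    (x₀ := u₀.proj) (x := u.proj) (by simpa using hu)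
  rw [FiberBundle.extChartAt]
  simp only [PartialEquiv.coe_trans, Function.comp_apply, PartialEquiv.prod_coe,
    PartialEquiv.refl_coe, id]
  refine Prod.ext rfl ?_
  change (trivializationAt (R3 →L[ℝ] E) _ u₀.proj u).2 = _
  rw [hom_trivializationAt_apply]
  ext v
  have hs : (trivializationAt R3 (Bundle.Trivial M R3) u₀.proj).symmL ℝ u.proj =
      ContinuousLinearMap.id ℝ R3 := Bundle.Trivial.symmL_trivialization ℝ M R3 _
  rw [ContinuousLinearMap.inCoordinates, h, hs]
  rfl

/-- The transition map from the preferred chart at `q` to the one at `q'`. -/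
def transition (q q' : M) (y : E) : E := extChartAt 𝓘(ℝ, E) q' ((extChartAt 𝓘(ℝ, E) q).symm y)

theorem contDiffAt_transition {q q' : M} {y : E} (hy : y ∈ (extChartAt 𝓘(ℝ, E) q).target)
    (hy' : (extChartAt 𝓘(ℝ, E) q).symm y ∈ (extChartAt 𝓘(ℝ, E) q').source) :
    ContDiffAt ℝ ∞ (transition q q') y := by
  have h1 := (contMDiffOn_extChartAt_symm (I := 𝓘(ℝ, E)) (n := ∞) q).contMDiffAt
    ((isOpen_extChartAt_target q).mem_nhds hy)
  have h2 := contMDiffAt_extChartAt' (I := 𝓘(ℝ, E)) (n := ∞) (x := q')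
    (x' := (extChartAt 𝓘(ℝ, E) q).symm y) (by simpa using hy')
  rw [← contMDiffAt_iff_contDiffAt]
  exact h2.comp y h1

theorem eventually_mem_transition {q q' : M} {y : E} (hy : y ∈ (extChartAt 𝓘(ℝ, E) q).target)
    (hy' : (extChartAt 𝓘(ℝ, E) q).symm y ∈ (extChartAt 𝓘(ℝ, E) q').source) :
    ∀ᶠ z in 𝓝 y, z ∈ (extChartAt 𝓘(ℝ, E) q).target ∧
      (extChartAt 𝓘(ℝ, E) q).symm z ∈ (extChartAt 𝓘(ℝ, E) q').source :=
  Filter.Eventually.and ((isOpen_extChartAt_target q).mem_nhds hy)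
    ((continuousAt_extChartAt_symm'' hy).preimage_mem_nhds
      ((isOpen_extChartAt_source q').mem_nhds hy'))

theorem chartDeriv_eq_fderiv_transition {q q' p : M} (hp : p ∈ (extChartAt 𝓘(ℝ, E) q).source)
    (hp' : p ∈ (extChartAt 𝓘(ℝ, E) q').source) (v : E) :
    chartDeriv E q' p v =
      fderiv ℝ (transition q q') (extChartAt 𝓘(ℝ, E) q p) (chartDeriv E q p v) := by
  have ht := (extChartAt 𝓘(ℝ, E) q).map_source hp
  have hl := (extChartAt 𝓘(ℝ, E) q).left_inv hp
  have hd := (contDiffAt_transition (q' := q') ht (by rwa [hl])).differentiableAt (by simp)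
  have he : extChartAt 𝓘(ℝ, E) q' =ᶠ[𝓝 p] transition q q' ∘ extChartAt 𝓘(ℝ, E) q := by
    filter_upwards [(isOpen_extChartAt_source q).mem_nhds hp] with z hz
    rw [Function.comp_apply, transition, (extChartAt 𝓘(ℝ, E) q).left_inv hz]
  have h1 := he.mfderiv_eq (I := 𝓘(ℝ, E)) (I' := 𝓘(ℝ, E))
  have h2 := mfderiv_comp p (I := 𝓘(ℝ, E)) (I' := 𝓘(ℝ, E)) (I'' := 𝓘(ℝ, E)) hd.mdifferentiableAt
    (mdifferentiableAt_extChartAt (by simpa using hp))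
  have h3 := DFunLike.congr_fun (h1.trans h2) v
  rw [mfderiv_eq_fderiv] at h3
  exact h3

theorem metricForm_transition (g : SmoothMetric E M) {q q' : M} {y : E}
    (hy : y ∈ (extChartAt 𝓘(ℝ, E) q).target)
    (hy' : (extChartAt 𝓘(ℝ, E) q).symm y ∈ (extChartAt 𝓘(ℝ, E) q').source) (a b : E) :
    metricForm g q y a b = metricForm g q' (transition q q' y)
      (fderiv ℝ (transition q q') y a) (fderiv ℝ (transition q q') y b) := by
  have hs := (extChartAt 𝓘(ℝ, E) q).map_target hy
  have hr := (extChartAt 𝓘(ℝ, E) q).right_inv hy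
  have key := fun v => chartDeriv_eq_fderiv_transition hs hy' (chartSymmDeriv q y v)
  simp only [chartDeriv_chartSymmDeriv hy, hr] at key
  rw [← key, ← key]
  exact (metricForm_chartDeriv g hy' _ _).symm

/-! ### Christoffel symbols under change of chart -/

section Christoffel

theorem _root_.HasFDerivAt.bilin_apply {F : Type*} [NormedAddCommGroup F] [NormedSpace ℝ F]
    {H : F → E →L[ℝ] E →L[ℝ] ℝ} {H' : F →L[ℝ] E →L[ℝ] E →L[ℝ] ℝ} {u v : F → E} {u' v' : F →L[ℝ] E}
    {x : F} (hH : HasFDerivAt H H' x) (hu : HasFDerivAt u u' x) (hv : HasFDerivAt v v' x) :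
    ∃ L : F →L[ℝ] ℝ, HasFDerivAt (fun z => H z (u z) (v z)) L x ∧
      ∀ w, L w = H' w (u x) (v x) + H x (u' w) (v x) + H x (u x) (v' w) := by
  refine ⟨_, (hH.clm_apply hu).clm_apply hv, fun w => ?_⟩
  simp only [add_apply, ContinuousLinearMap.comp_apply,
    ContinuousLinearMap.flip_apply]
  ring

variable (H : E → E →L[ℝ] E →L[ℝ] ℝ)

/-- The Christoffel symbols of the first kind of a field of bilinear forms. -/
def christoffelForm (y a b c : E) : ℝ :=
  (fderiv ℝ H y a b c + fderiv ℝ H y b a c - fderiv ℝ H y c a b) / 2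

variable {H}

/-- Differentiating the pull-back relation yields six terms in the second derivative of `τ`. By
symmetry of that derivative and of `H'`, four cancel and the other two coincide, absorbing the
factor 1/2. -/
theorem christoffelForm_transition {H' : E → E →L[ℝ] E →L[ℝ] ℝ} {τ : E → E} {y : E}
    (hτ : ContDiffAt ℝ 2 τ y) (hH' : DifferentiableAt ℝ H' (τ y))
    (hsymm : ∀ a b, H' (τ y) a b = H' (τ y) b a)
    (hH : ∀ᶠ z in 𝓝 y, ∀ a b, H z a b = H' (τ z) (fderiv ℝ τ z a) (fderiv ℝ τ z b))
    (hHd : DifferentiableAt ℝ H y) (a b c : E) :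
    christoffelForm H y a b c =
      christoffelForm H' (τ y) (fderiv ℝ τ y a) (fderiv ℝ τ y b) (fderiv ℝ τ y c)
      + H' (τ y) (fderiv ℝ (fderiv ℝ τ) y a b) (fderiv ℝ τ y c) := by
  have hτ1 : HasFDerivAt τ (fderiv ℝ τ y) y := (hτ.differentiableAt (by simp)).hasFDerivAt
  have hτ2 : HasFDerivAt (fderiv ℝ τ) (fderiv ℝ (fderiv ℝ τ) y) y :=
    ((hτ.fderiv_right (m := 1) (by norm_num)).differentiableAt (by simp)).hasFDerivAt
  have hsym2 : ∀ v w, fderiv ℝ (fderiv ℝ τ) y v w = fderiv ℝ (fderiv ℝ τ) y w v :=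
    fun v w => (hτ.isSymmSndFDerivAt (by simp)).eq v w
  have key : ∀ v b c, fderiv ℝ H y v b c =
      fderiv ℝ H' (τ y) (fderiv ℝ τ y v) (fderiv ℝ τ y b) (fderiv ℝ τ y c)
      + H' (τ y) (fderiv ℝ (fderiv ℝ τ) y v b) (fderiv ℝ τ y c)
      + H' (τ y) (fderiv ℝ τ y b) (fderiv ℝ (fderiv ℝ τ) y v c) := by
    intro v b c
    obtain ⟨L₁, h1, hL₁⟩ := (hH'.hasFDerivAt.comp y hτ1).bilin_apply
      (hτ2.clm_apply (hasFDerivAt_const b y)) (hτ2.clm_apply (hasFDerivAt_const c y))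
    obtain ⟨L₂, h2, hL₂⟩ := hHd.hasFDerivAt.bilin_apply
      (hasFDerivAt_const b y) (hasFDerivAt_const c y)
    have h3 := h2.unique (h1.congr_of_eventuallyEq (by
      filter_upwards [hH] with z hz using hz b c))
    have h4 := DFunLike.congr_fun h3 v
    rw [hL₁, hL₂] at h4
    simpa using h4
  simp only [christoffelForm, key]
  rw [hsym2 b a, hsym2 c a, hsym2 c b, hsymm (fderiv ℝ τ y b) (fderiv ℝ (fderiv ℝ τ) y a c),
    hsymm (fderiv ℝ τ y a) (fderiv ℝ (fderiv ℝ τ) y b c)]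
  ring

end Christoffel

theorem christoffel_eq (g : SmoothMetric E M) {q : M} {y : E}
    (hy : y ∈ (extChartAt 𝓘(ℝ, E) q).target) (a b c : E) :
    christoffel g q y a b c = christoffelForm (metricForm g q) y a b c := by
  have hd := ((contDiffAt_metricForm g hy).differentiableAt (by simp)).hasFDerivAt
  have key : ∀ v b c, fderiv ℝ (fun z => coordMetric g q z b c) y v =
      fderiv ℝ (metricForm g q) y v b c := by
    intro v b c
    obtain ⟨L, h, hL⟩ := hd.bilin_apply (hasFDerivAt_const b y) (hasFDerivAt_const c y)
    simp only [coordMetric_eq]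
    rw [h.fderiv, hL]
    simp
  simp only [christoffel, key, christoffelForm]

/-- The components of a tangent vector at `u` in the preferred chart at `u₀`. -/
def coordVectorAt (u₀ u : TripleBundle E M) (v : TangentSpace (tripleModel E) u) :
    E × (R3 →L[ℝ] E) :=
  mfderiv (tripleModel E) 𝓘(ℝ, E × (R3 →L[ℝ] E)) (extChartAt (tripleModel E) u₀) u v

theorem mem_chartAt_tripleBundle_source {u₀ u : TripleBundle E M}
    (hu : u.proj ∈ (extChartAt 𝓘(ℝ, E) u₀.proj).source) :
    u ∈ (chartAt (ModelProd E (R3 →L[ℝ] E)) u₀).source := by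
  rw [← extChartAt_source (tripleModel E)]
  exact mem_extChartAt_tripleBundle_source.2 hu

theorem eventually_mem_source {u₀ u : TripleBundle E M}
    (hu : u.proj ∈ (extChartAt 𝓘(ℝ, E) u₀.proj).source) :
    ∀ᶠ w in 𝓝 u, w.proj ∈ (extChartAt 𝓘(ℝ, E) u₀.proj).source := by
  filter_upwards [(isOpen_extChartAt_source (I := tripleModel E) u₀).mem_nhds
    (mem_extChartAt_tripleBundle_source.2 hu)] with w hw
  exact mem_extChartAt_tripleBundle_source.1 hw

theorem mdifferentiableAt_proj (u : TripleBundle E M) :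
    MDifferentiableAt (tripleModel E) 𝓘(ℝ, E) (fun w : TripleBundle E M => w.proj) u :=
  (contMDiffAt_proj (fun p : M => Bundle.Trivial M R3 p →L[ℝ] TangentSpace 𝓘(ℝ, E) p)
    (n := 1)).mdifferentiableAt (by simp)

theorem coordVectorAt_fst {u₀ u : TripleBundle E M}
    (hu : u.proj ∈ (extChartAt 𝓘(ℝ, E) u₀.proj).source) (v : TangentSpace (tripleModel E) u) :
    (coordVectorAt u₀ u v).1 = chartDeriv E u₀.proj u.proj (projDeriv u v) := by
  have h1 : HasMFDerivAt (tripleModel E) 𝓘(ℝ, E × (R3 →L[ℝ] E)) (extChartAt (tripleModel E) u₀) u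
      _ := (mdifferentiableAt_extChartAt (mem_chartAt_tripleBundle_source hu)).hasMFDerivAt
  have h2 : HasMFDerivAt (tripleModel E) 𝓘(ℝ, E)
      (fun w => (extChartAt (tripleModel E) u₀ w).1) u _ :=
    (ContinuousLinearMap.fst ℝ E (R3 →L[ℝ] E)).hasMFDerivAt.comp u h1
  have h3 : HasMFDerivAt (tripleModel E) 𝓘(ℝ, E)
      (fun w : TripleBundle E M => extChartAt 𝓘(ℝ, E) u₀.proj w.proj) u _ :=
    (mdifferentiableAt_extChartAt (I := 𝓘(ℝ, E)) (by simpa using hu)).hasMFDerivAt.comp u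
      (mdifferentiableAt_proj u).hasMFDerivAt
  have h4 := h3.congr_of_eventuallyEq (f₁ := fun w => (extChartAt (tripleModel E) u₀ w).1) (by
    filter_upwards [eventually_mem_source hu] with w hw
    rw [extChartAt_tripleBundle hw])
  exact DFunLike.congr_fun (hasMFDerivAt_unique h2 h4) v

theorem canonicalForm_eq (g : SmoothMetric E M) {u₀ u : TripleBundle E M}
    (hu : u.proj ∈ (extChartAt 𝓘(ℝ, E) u₀.proj).source) (v : TangentSpace (tripleModel E) u)
    (i : Fin 3) :
    canonicalForm g u v i = metricForm g u₀.proj (extChartAt (tripleModel E) u₀ u).1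
      ((extChartAt (tripleModel E) u₀ u).2 (stdVec i)) (coordVectorAt u₀ u v).1 := by
  rw [coordVectorAt_fst hu, extChartAt_tripleBundle hu]
  exact (metricForm_chartDeriv g hu _ _).symm

/-- The change of bundle charts is (y, B) ↦ (τ y, Dτ(y) ∘ B); the product rule in the fibre gives
the extra term D²τ(ẏ) ∘ B. -/
theorem coordVectorAt_eq {u₀ u : TripleBundle E M}
    (hu : u.proj ∈ (extChartAt 𝓘(ℝ, E) u₀.proj).source) (v : TangentSpace (tripleModel E) u) :
    coordVectorAt u₀ u v =
      (fderiv ℝ (transition u.proj u₀.proj) (extChartAt (tripleModel E) u u).1 (coordVector u v).1,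
      (fderiv ℝ (transition u.proj u₀.proj) (extChartAt (tripleModel E) u u).1).comp
          (coordVector u v).2 +
        (fderiv ℝ (fderiv ℝ (transition u.proj u₀.proj)) (extChartAt (tripleModel E) u u).1
          (coordVector u v).1).comp (extChartAt (tripleModel E) u u).2) := by
  have hp := mem_extChartAt_source (I := 𝓘(ℝ, E)) u.proj
  set τ : E → E := transition u.proj u₀.proj with hτ
  set z := extChartAt (tripleModel E) u u with hz
  have hz1 : z.1 = extChartAt 𝓘(ℝ, E) u.proj u.proj := by rw [hz, extChartAt_tripleBundle hp]
  have hs : ContDiffAt ℝ ∞ τ z.1 := by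
    rw [hz1]
    refine contDiffAt_transition (mem_extChartAt_target _) ?_
    rwa [(extChartAt 𝓘(ℝ, E) u.proj).left_inv hp]
  have hτ1 : HasFDerivAt τ (fderiv ℝ τ z.1) z.1 := (hs.differentiableAt (by simp)).hasFDerivAt
  have hτ2 : HasFDerivAt (fderiv ℝ τ) (fderiv ℝ (fderiv ℝ τ) z.1) z.1 :=
    ((hs.fderiv_right (m := 1) (by norm_cast)).differentiableAt (by simp)).hasFDerivAt
  have hΦ : HasFDerivAt (fun w : E × (R3 →L[ℝ] E) => (τ w.1, (fderiv ℝ τ w.1).comp w.2)) _ z :=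
    (hτ1.comp z hasFDerivAt_fst).prodMk ((hτ2.comp z hasFDerivAt_fst).clm_comp hasFDerivAt_snd)
  have h1 : HasMFDerivAt (tripleModel E) 𝓘(ℝ, E × (R3 →L[ℝ] E)) (extChartAt (tripleModel E) u) u
      _ := (mdifferentiableAt_extChartAt (mem_chartAt_tripleBundle_source hp)).hasMFDerivAt
  have h2 := (hΦ.hasMFDerivAt.comp u h1).congr_of_eventuallyEq
    (f₁ := extChartAt (tripleModel E) u₀) (by
      filter_upwards [eventually_mem_source hu, eventually_mem_source hp] with w hw hw'
      rw [Function.comp_apply, extChartAt_tripleBundle hw, extChartAt_tripleBundle hw']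
      refine Prod.ext ?_ ?_
      · simp only [hτ, transition, (extChartAt 𝓘(ℝ, E) u.proj).left_inv hw']
      · ext a
        exact chartDeriv_eq_fderiv_transition hw' hw _)
  have h3 := DFunLike.congr_fun h2.mfderiv v
  refine h3.trans (Prod.ext ?_ ?_)
  · rfl
  · rfl

theorem innerModel_symm (g : SmoothMetric E M) (p : M) (a b : E) :
    innerModel g p a b = innerModel g p b a := g.symm p a b

theorem metricForm_symm (g : SmoothMetric E M) (q : M) (y a b : E) :
    metricForm g q y a b = metricForm g q y b a := by
  simp only [metricForm, ContinuousLinearMap.bilinearComp_apply]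
  exact innerModel_symm g _ _ _

/-- Chart independence of ω: the second-derivative term of the fibre velocity is exactly the
inhomogeneous term in the transformation law of the Christoffel symbols. This permits
differentiating ω along curves in one fixed chart. -/
theorem connectionForm_eq (g : SmoothMetric E M) {u₀ u : TripleBundle E M}
    (hu : u.proj ∈ (extChartAt 𝓘(ℝ, E) u₀.proj).source) (v : TangentSpace (tripleModel E) u)
    (i j : Fin 3) :
    connectionForm g u v i j = metricForm g u₀.proj (extChartAt (tripleModel E) u₀ u).1
        ((extChartAt (tripleModel E) u₀ u).2 (stdVec i)) ((coordVectorAt u₀ u v).2 (stdVec j))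
      + christoffelForm (metricForm g u₀.proj) (extChartAt (tripleModel E) u₀ u).1
        (coordVectorAt u₀ u v).1 ((extChartAt (tripleModel E) u₀ u).2 (stdVec j))
        ((extChartAt (tripleModel E) u₀ u).2 (stdVec i)) := by
  have hp := mem_extChartAt_source (I := 𝓘(ℝ, E)) u.proj
  have ht := mem_extChartAt_target (I := 𝓘(ℝ, E)) u.proj
  have hl := (extChartAt 𝓘(ℝ, E) u.proj).left_inv hp
  have hl' : (extChartAt 𝓘(ℝ, E) u.proj).symm (extChartAt 𝓘(ℝ, E) u.proj u.proj) ∈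
    (extChartAt 𝓘(ℝ, E) u₀.proj).source := by rwa [hl]
  have hty : transition u.proj u₀.proj (extChartAt 𝓘(ℝ, E) u.proj u.proj) =
    extChartAt 𝓘(ℝ, E) u₀.proj u.proj := by rw [transition, hl]
  have hC : ∀ a, (extChartAt (tripleModel E) u₀ u).2 a = fderiv ℝ (transition u.proj u₀.proj)
      (extChartAt 𝓘(ℝ, E) u.proj u.proj) ((extChartAt (tripleModel E) u u).2 a) := by
    intro a
    rw [extChartAt_tripleBundle hu, extChartAt_tripleBundle hp]
    exact chartDeriv_eq_fderiv_transition hp hu _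
  have h1 : (extChartAt (tripleModel E) u u).1 = extChartAt 𝓘(ℝ, E) u.proj u.proj := by
    rw [extChartAt_tripleBundle hp]
  have h0 : (extChartAt (tripleModel E) u₀ u).1 = extChartAt 𝓘(ℝ, E) u₀.proj u.proj := by
    rw [extChartAt_tripleBundle hu]
  have hsymm : ∀ a b, metricForm g u₀.proj (extChartAt 𝓘(ℝ, E) u₀.proj u.proj) a b =
      metricForm g u₀.proj (extChartAt 𝓘(ℝ, E) u₀.proj u.proj) b a := metricForm_symm g _ _
  simp only [connectionForm]
  rw [coordVectorAt_eq hu, h0]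
  simp only [hC]
  rw [h1, christoffel_eq g ht, coordMetric_eq, metricForm_transition g ht hl']
  rw [christoffelForm_transition (H' := metricForm g u₀.proj) (τ := transition u.proj u₀.proj)
    ((contDiffAt_transition ht hl').of_le (by norm_cast)) ?_ ?_ ?_ ?_, hty]
  · simp only [add_apply, map_add, ContinuousLinearMap.comp_apply]
    rw [hsymm (fderiv ℝ (fderiv ℝ _) _ _ _)]
    ring
  · rw [hty]
    exact (contDiffAt_metricForm g ((extChartAt 𝓘(ℝ, E) u₀.proj).map_source hu)).differentiableAt
      (by simp)
  · rw [hty]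
    exact hsymm
  · filter_upwards [eventually_mem_transition ht hl'] with z hz a b
    exact metricForm_transition g hz.1 hz.2 a b
  · exact (contDiffAt_metricForm g ht).differentiableAt (by simp)

/-! ### The first variation in local coordinates -/

section Calculus

theorem _root_.HasDerivAt.bilin_apply {H : ℝ → E →L[ℝ] E →L[ℝ] ℝ} {H' : E →L[ℝ] E →L[ℝ] ℝ}
    {u v : ℝ → E} {u' v' : E} {s : ℝ} (hH : HasDerivAt H H' s) (hu : HasDerivAt u u' s)
    (hv : HasDerivAt v v' s) :
    HasDerivAt (fun r => H r (u r) (v r))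
      (H' (u s) (v s) + H s u' (v s) + H s (u s) v') s := by
  have h := (hH.clm_apply hu).clm_apply hv
  simpa only [add_apply] using h

variable {H : E → E →L[ℝ] E →L[ℝ] ℝ} {y : E}

theorem fderiv_form_symm (hH : DifferentiableAt ℝ H y) (hsymm : ∀ z a b, H z a b = H z b a)
    (w a b : E) : fderiv ℝ H y w a b = fderiv ℝ H y w b a := by
  obtain ⟨L₁, h₁, hL₁⟩ := hH.hasFDerivAt.bilin_apply (hasFDerivAt_const a y) (hasFDerivAt_const b y)
  obtain ⟨L₂, h₂, hL₂⟩ := hH.hasFDerivAt.bilin_apply (hasFDerivAt_const b y) (hasFDerivAt_const a y)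
  simp only [hsymm _ a b] at h₁
  have h := DFunLike.congr_fun (h₁.unique h₂) w
  rw [hL₁, hL₂] at h
  simpa using h

/-- Metric compatibility of the Levi-Civita connection; it makes ω skew on velocities of orthonormal
frames. -/
theorem fderiv_form_eq_christoffelForm (hH : DifferentiableAt ℝ H y)
    (hsymm : ∀ z a b, H z a b = H z b a) (w a b : E) :
    fderiv ℝ H y w a b = christoffelForm H y w a b + christoffelForm H y w b a := by
  simp only [christoffelForm]
  rw [fderiv_form_symm hH hsymm w b a]
  ring

/-- Differentiating a Christoffel expression along a curve whose base point and first argument are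
stationary. -/
theorem hasDerivAt_christoffelForm (hH : ContDiffAt ℝ 2 H y) {x T B C : ℝ → E} {B' C' : E} {s : ℝ}
    (hxs : x s = y) (hx : HasDerivAt x 0 s) (hT : HasDerivAt T 0 s) (hB : HasDerivAt B B' s)
    (hC : HasDerivAt C C' s) :
    HasDerivAt (fun r => christoffelForm H (x r) (T r) (B r) (C r))
      (christoffelForm H y (T s) B' (C s) + christoffelForm H y (T s) (B s) C') s := by
  have hd : HasDerivAt (fun r => fderiv ℝ H (x r)) 0 s := by
    have h := ((hH.fderiv_right (m := 1) (by norm_num)).differentiableAt (by simp)).hasFDerivAt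
    rw [← hxs] at h
    have h2 := h.comp_hasDerivAt s hx
    rw [map_zero] at h2
    exact h2
  have key : ∀ {U V W : ℝ → E} {U' V' W' : E}, HasDerivAt U U' s → HasDerivAt V V' s →
      HasDerivAt W W' s → HasDerivAt (fun r => fderiv ℝ H (x r) (U r) (V r) (W r))
        (fderiv ℝ H y U' (V s) (W s) + fderiv ℝ H y (U s) V' (W s)
          + fderiv ℝ H y (U s) (V s) W') s := by
    intro U V W U' V' W' hU hV hW
    refine ((hd.clm_apply hU).bilin_apply hV hW).congr_deriv ?_
    simp only [add_apply, zero_apply, hxs]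
    ring
  have h := (((key hT hB hC).add (key hB hT hC)).sub (key hC hT hB)).div_const 2
  refine h.congr_deriv ?_
  simp only [christoffelForm, map_zero, zero_apply]
  ring

/-- The relations force linear independence, and three independent vectors span in dimension 3;
positivity of `h` plays no role. -/
theorem orthonormal_expansion (hE : Module.finrank ℝ E = 3) {h : E →L[ℝ] E →L[ℝ] ℝ}
    {C : Fin 3 → E} (hon : ∀ i j, h (C i) (C j) = if i = j then 1 else 0) (w : E) :
    w = h (C 0) w • C 0 + h (C 1) w • C 1 + h (C 2) w • C 2 := by
  have hli : LinearIndependent ℝ C := by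
    rw [Fintype.linearIndependent_iff]
    intro c hc i
    have := congrArg (h (C i)) hc
    simpa [map_sum, hon] using this
  have hsp := hli.span_eq_top_of_card_eq_finrank (by simp [hE])
  have hw : w ∈ Submodule.span ℝ (range C) := by rw [hsp]; trivial
  obtain ⟨c, rfl⟩ := (Submodule.mem_span_range_iff_exists_fun ℝ).1 hw
  simp [Fin.sum_univ_three, hon]

theorem hasDerivAt_comp_fst {F : Type*} [NormedAddCommGroup F] [NormedSpace ℝ F] {f : ℝ × ℝ → F}
    {ε t : ℝ} (hf : DifferentiableAt ℝ f (ε, t)) :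
    HasDerivAt (fun r => f (r, t)) (fderiv ℝ f (ε, t) (1, 0)) ε :=
  hf.hasFDerivAt.comp_hasDerivAt (f := fun r => (r, t)) ε
    ((hasDerivAt_id ε).prodMk (hasDerivAt_const ε t))

theorem hasDerivAt_comp_snd {F : Type*} [NormedAddCommGroup F] [NormedSpace ℝ F] {f : ℝ × ℝ → F}
    {ε t : ℝ} (hf : DifferentiableAt ℝ f (ε, t)) :
    HasDerivAt (fun r => f (ε, r)) (fderiv ℝ f (ε, t) (0, 1)) t :=
  hf.hasFDerivAt.comp_hasDerivAt (f := fun r => (ε, r)) t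
    ((hasDerivAt_const t ε).prodMk (hasDerivAt_id t))

/-- Equality of mixed partial derivatives, in terms of derivatives of partial derivatives. -/
theorem hasDerivAt_partial {F : Type*} [NormedAddCommGroup F] [NormedSpace ℝ F] {f : ℝ × ℝ → F}
    {ε t : ℝ} (hf : ContDiffAt ℝ 2 f (ε, t)) :
    ∃ X, HasDerivAt (fun r => fderiv ℝ f (r, t) (0, 1)) X ε ∧
      HasDerivAt (fun r => fderiv ℝ f (ε, r) (1, 0)) X t := by
  have hd := (hf.fderiv_right (m := 1) (by norm_num)).differentiableAt (by simp)
  refine ⟨fderiv ℝ (fderiv ℝ f) (ε, t) (1, 0) (0, 1), ?_, ?_⟩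
  · have h := (hasDerivAt_comp_fst hd).clm_apply (hasDerivAt_const ε ((0 : ℝ), (1 : ℝ)))
    simpa using h
  · have h := (hasDerivAt_comp_snd hd).clm_apply (hasDerivAt_const t ((1 : ℝ), (0 : ℝ)))
    rw [(hf.isSymmSndFDerivAt (by simp)).eq]
    simpa using h

/-- The first variation of the Kropina integrand in local coordinates. For a vertical variation of
a lift of a curve, the variation of the integrand is a total derivative. -/
theorem exists_hasDerivAt_kropina (hE : Module.finrank ℝ E = 3) (hsymm : ∀ z a b, H z a b = H z b a)
    {Y : ℝ × ℝ → E} {C : Fin 3 → ℝ × ℝ → E} {t f : ℝ} (hH : ContDiffAt ℝ 2 H (Y (0, t)))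
    (hY : ContDiffAt ℝ 2 Y (0, t)) (hC : ∀ i, ContDiffAt ℝ 2 (C i) (0, t))
    (hon : ∀ᶠ p in 𝓝 ((0 : ℝ), t), ∀ i j, H (Y p) (C i p) (C j p) = if i = j then 1 else 0)
    (hvert : ∀ᶠ r in 𝓝 t, fderiv ℝ Y (0, r) (1, 0) = 0)
    (hf : f ≠ 0) (hT : fderiv ℝ Y (0, t) (0, 1) = f • C 2 (0, t))
    {φ : Fin 3 → ℝ × ℝ → ℝ} {κ : Fin 3 → Fin 3 → ℝ × ℝ → ℝ}
    (hφ : ∀ i, ∀ᶠ p in 𝓝 ((0 : ℝ), t), φ i p = H (Y p) (C i p) (fderiv ℝ Y p (0, 1)))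
    (hκ : ∀ i j, ∀ᶠ p in 𝓝 ((0 : ℝ), t), κ i j p = H (Y p) (C i p) (fderiv ℝ (C j) p (0, 1))
      + christoffelForm H (Y p) (fderiv ℝ Y p (0, 1)) (C j p) (C i p)) :
    ∃ c, HasDerivAt (fun ε => 2 * (φ 0 (ε, t) * κ 1 2 (ε, t) + φ 1 (ε, t) * κ 2 0 (ε, t)
        + φ 2 (ε, t) * κ 0 1 (ε, t)) / φ 2 (ε, t)) (2 * c) 0 ∧
      HasDerivAt (fun r => H (Y (0, r)) (C 0 (0, r)) (fderiv ℝ (C 1) (0, r) (1, 0))) c t := by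
  have hHd : DifferentiableAt ℝ H (Y (0, t)) := hH.differentiableAt (by simp)
  have hYd : DifferentiableAt ℝ Y (0, t) := hY.differentiableAt (by simp)
  have hCd : ∀ i, DifferentiableAt ℝ (C i) (0, t) := fun i => (hC i).differentiableAt (by simp)
  have hon0 := hon.self_of_nhds
  have hεcont : ContinuousAt (fun ε : ℝ => (ε, t)) 0 := by fun_prop
  have htcont : ContinuousAt (fun r : ℝ => ((0 : ℝ), r)) t := by fun_prop
  choose X hXε hXt using fun i => hasDerivAt_partial (hC i)
  obtain ⟨Z, hZε, hZt⟩ := hasDerivAt_partial hY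
  -- The variation is vertical at all nearby times, not just at `t`, so the mixed derivative of the
  -- base point vanishes too: its velocity is also stationary in ε. This is why no curvature term
  -- appears.
  have hZ : Z = 0 := hZt.unique ((hasDerivAt_const t (0 : E)).congr_of_eventuallyEq hvert)
  subst hZ
  have hYε : HasDerivAt (fun ε => Y (ε, t)) 0 0 := by
    have h := hasDerivAt_comp_fst hYd
    rwa [hvert.self_of_nhds] at h
  have hYt := hasDerivAt_comp_snd hYd
  have hCε := fun i => hasDerivAt_comp_fst (hCd i)
  have hCt := fun i => hasDerivAt_comp_snd (hCd i)
  have hHε : HasDerivAt (fun ε => H (Y (ε, t))) 0 0 := by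
    have h := hHd.hasFDerivAt.comp_hasDerivAt (f := fun ε => Y (ε, t)) 0 hYε
    rw [map_zero] at h
    exact h
  have hHt : HasDerivAt (fun r => H (Y (0, r))) 
      (fderiv ℝ H (Y (0, t)) (fderiv ℝ Y (0, t) (0, 1))) t :=
    hHd.hasFDerivAt.comp_hasDerivAt (f := fun r => Y (0, r)) t hYt
  set D : Fin 3 → E := fun i => fderiv ℝ (C i) (0, t) (1, 0) with hD
  set S : Fin 3 → E := fun i => fderiv ℝ (C i) (0, t) (0, 1) with hS
  set T : E := fderiv ℝ Y (0, t) (0, 1) with hTdef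
  set h₀ := H (Y (0, t)) with hh₀
  set B : Fin 3 → E := fun i => C i (0, t) with hB
  -- the variation and the velocity of an orthonormal frame are skew
  have hVskew : ∀ i j, h₀ (D i) (B j) + h₀ (B i) (D j) = 0 := by
    intro i j
    have h := (hHε.bilin_apply (hCε i) (hCε j)).unique
      ((hasDerivAt_const (0 : ℝ) (if i = j then (1 : ℝ) else 0)).congr_of_eventuallyEq
        ((hεcont.eventually hon).mono fun ε h => h i j))
    simpa using h
  have hWskew : ∀ i j,
      fderiv ℝ H (Y (0, t)) T (B i) (B j) + h₀ (S i) (B j) + h₀ (B i) (S j) = 0 := by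
    intro i j
    exact (hHt.bilin_apply (hCt i) (hCt j)).unique
      ((hasDerivAt_const t (if i = j then (1 : ℝ) else 0)).congr_of_eventuallyEq
        ((htcont.eventually hon).mono fun ε h => h i j))
  set W : Fin 3 → Fin 3 → ℝ := fun i j => h₀ (B i) (S j)
    + christoffelForm H (Y (0, t)) T (B j) (B i) with hW
  have hWs : ∀ i j, W i j + W j i = 0 := by
    intro i j
    have h1 := hWskew i j
    rw [fderiv_form_eq_christoffelForm hHd hsymm, hsymm _ (S i)] at h1
    simp only [hW]
    linarith
  have hexp : ∀ w, w = h₀ (B 0) w • B 0 + h₀ (B 1) w • B 1 + h₀ (B 2) w • B 2 :=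
    orthonormal_expansion hE hon0
  -- The left side is h₀ of `w` with the covariant derivative of the `j`-th frame vector; expanding
  -- `w` in the frame expresses it through `W`.
  have hlin : ∀ w j, h₀ w (S j) + christoffelForm H (Y (0, t)) T (B j) w =
      h₀ (B 0) w * W 0 j + h₀ (B 1) w * W 1 j + h₀ (B 2) w * W 2 j := by
    intro w j
    -- Naming the coefficients keeps the rewriting of `w` from acting inside them.
    obtain ⟨r₀, r₁, r₂, hr₀, hr₁, hr₂⟩ : ∃ r₀ r₁ r₂ : ℝ, r₀ = h₀ (B 0) w ∧ r₁ = h₀ (B 1) w ∧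
      r₂ = h₀ (B 2) w := ⟨_, _, _, rfl, rfl, rfl⟩
    have hw := hexp w
    rw [← hr₀, ← hr₁, ← hr₂] at hw ⊢
    rw [hw]
    simp only [hW, christoffelForm, map_add, map_smul, add_apply, smul_apply, smul_eq_mul]
    ring
  have hφ0 : ∀ i, φ i (0, t) = if i = 2 then f else 0 := by
    intro i
    rw [(hφ i).self_of_nhds, ← hTdef, hT, map_smul, hon0 i 2]
    simp
  have hφd : ∀ i, HasDerivAt (fun ε => φ i (ε, t)) (f * h₀ (D i) (B 2)) 0 := by
    intro i
    refine ((hHε.bilin_apply (hCε i) hZε).congr_of_eventuallyEq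
      (hεcont.eventually (hφ i))).congr_deriv ?_
    rw [← hTdef, hT]
    simp [hD, hB, hh₀]
  have hκ0 : ∀ i j, κ i j (0, t) = W i j := fun i j => (hκ i j).self_of_nhds
  have hκd : ∀ i j, HasDerivAt (fun ε => κ i j (ε, t)) (h₀ (D i) (S j) + h₀ (B i) (X j)
      + christoffelForm H (Y (0, t)) T (D j) (B i)
      + christoffelForm H (Y (0, t)) T (B j) (D i)) 0 := by
    intro i j
    refine (((hHε.bilin_apply (hCε i) (hXε j)).add (hasDerivAt_christoffelForm hH
      (x := fun ε => Y (ε, t)) rfl hYε hZε (hCε j) (hCε i))).congr_of_eventuallyEq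
      (hεcont.eventually (hκ i j))).congr_deriv ?_
    simp only [zero_apply, zero_add, add_assoc]
    rfl
  have hv := hHt.bilin_apply (hCt 0) (hXt 1)
  refine ⟨_, ?_, hv⟩
  refine (((((hφd 0).mul (hκd 1 2)).add ((hφd 1).mul (hκd 2 0))).add
    ((hφd 2).mul (hκd 0 1))).const_mul 2).div (hφd 2) (by simpa [hφ0] using hf) |>.congr_deriv ?_
  simp only [hφ0, hκ0, Pi.add_apply, Pi.mul_apply]
  simp only [show ((0 : Fin 3) = 2) = False by simp, show ((1 : Fin 3) = 2) = False by simp,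
    if_true, if_false]
  -- These two expansions give the commutator [W, v]₀₁; skewness leaves only -v₂₀ W₁₂ from the first
  -- and v₂₁ W₂₀ from the second.
  have e1 := hlin (D 0) 1
  have e2 := hlin (D 1) 0
  have w00 : W 0 0 = 0 := by linarith [hWs 0 0]
  have w11 : W 1 1 = 0 := by linarith [hWs 1 1]
  have w21 : W 2 1 = -W 1 2 := by linarith [hWs 1 2]
  have v00 : h₀ (B 0) (D 0) = 0 := by linarith [hVskew 0 0, hsymm (Y (0, t)) (B 0) (D 0)]
  have v11 : h₀ (B 1) (D 1) = 0 := by linarith [hVskew 1 1, hsymm (Y (0, t)) (B 1) (D 1)]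
  rw [w11, w21, v00, hsymm _ (B 2)] at e1
  rw [w00, v11, hsymm _ (B 2), hsymm _ (D 1) (S 0)] at e2
  have d1 := fderiv_form_eq_christoffelForm hHd hsymm T (B 0) (D 1)
  change _ = 2 * (fderiv ℝ H (Y (0, t)) T (B 0) (D 1) + h₀ (S 0) (D 1) + h₀ (B 0) (X 1))
  rw [div_eq_iff (pow_ne_zero 2 hf), d1]
  linear_combination 2 * f ^ 2 * e1 - 2 * f ^ 2 * e2

end Calculus

/-! ### Differentiation under the integral -/

section ParametricIntegral

/-- Differentiation of a parametric integral whose integrand has a total derivative as its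
variation. -/
theorem hasDerivAt_integral_of_variation_eq_deriv {L : ℝ → ℝ → ℝ} {v : ℝ → ℝ} {a b η : ℝ}
    (hab : a < b) (hη : 0 < η)
    (hL : ContDiffOn ℝ 1 (fun p : ℝ × ℝ => L p.1 p.2) (Icc (-η) η ×ˢ Icc a b))
    (hv : ContinuousOn v (Icc a b)) (hva : v a = 0) (hvb : v b = 0)
    (hder : ∀ t ∈ Ioo a b, ∃ c, HasDerivAt (fun ε => L ε t) (2 * c) 0 ∧ HasDerivAt v c t) :
    HasDerivAt (fun ε => ∫ t in a..b, L ε t) 0 0 := by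
  set Q : Set (ℝ × ℝ) := Icc (-η) η ×ˢ Icc a b with hQ
  have hQc : IsCompact Q := isCompact_Icc.prod isCompact_Icc
  have hQconv : Convex ℝ Q := (convex_Icc _ _).prod (convex_Icc _ _)
  have hQu : UniqueDiffOn ℝ Q := (uniqueDiffOn_Icc (by linarith)).prod (uniqueDiffOn_Icc hab)
  -- The derivative is bounded on the compact convex rectangle, so `L` is Lipschitz there; the
  -- constant `K` serves as the dominating function.
  obtain ⟨K, hK⟩ := hQc.exists_bound_of_continuousOn (hL.continuousOn_fderivWithin hQu le_rfl)
  have hlip : LipschitzOnWith (Real.nnabs K) (fun p : ℝ × ℝ => L p.1 p.2) Q := by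
    refine hQconv.lipschitzOnWith_of_nnnorm_fderivWithin_le
      (hL.differentiableOn (by simp)) fun p hp => ?_
    rw [← NNReal.coe_le_coe]
    simpa using (hK p hp).trans (le_abs_self K)
  have hcont : ∀ ε ∈ Icc (-η) η, ContinuousOn (L ε) (Icc a b) := fun ε hε =>
    hL.continuousOn.comp (f := fun t => (ε, t)) (by fun_prop) fun t ht => ⟨hε, ht⟩
  have hI : Icc (-η) η ∈ 𝓝 (0 : ℝ) := Icc_mem_nhds (by linarith) hη
  have hint : ∀ ε ∈ Icc (-η) η, IntervalIntegrable (L ε) volume a b := fun ε hε =>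
    ((hcont ε hε).mono (by rw [uIcc_of_le hab.le])).intervalIntegrable
  -- The variation formula is known only in the open interval; the endpoint `b` of `uIoc` is a null
  -- set.
  have hae : ∀ᵐ t : ℝ, t ∈ uIoc a b → t ∈ Ioo a b := by
    have : ∀ᵐ t : ℝ, t ≠ b := by simp [ae_iff]
    filter_upwards [this] with t ht htab
    rw [uIoc_of_le hab.le] at htab
    exact ⟨htab.1, lt_of_le_of_ne htab.2 ht⟩
  have hderiv : ∀ t ∈ Ioo a b, HasDerivAt (fun ε => L ε t) (2 * deriv v t) 0 ∧
      HasDerivAt v (deriv v t) t := by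
    intro t ht
    obtain ⟨c, h1, h2⟩ := hder t ht
    rw [h2.deriv]
    exact ⟨h1, h2⟩
  obtain ⟨hi, hd⟩ := intervalIntegral.hasDerivAt_integral_of_dominated_loc_of_lip
    (μ := volume) (a := a) (b := b) (F := L) (F' := fun t => 2 * deriv v t) (x₀ := 0)
    (bound := fun _ => K) hI
    (by
      filter_upwards [hI] with ε hε
      exact (intervalIntegrable_iff.1 (hint ε hε)).aestronglyMeasurable)
    (hint 0 (mem_of_mem_nhds hI))
    ((measurable_deriv v).const_mul 2).aestronglyMeasurable
    (by
      filter_upwards [hae] with t ht htab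
      have ht' := Ioo_subset_Icc_self (ht htab)
      refine LipschitzOnWith.of_dist_le_mul fun x hx z hz => ?_
      have := hlip.dist_le_mul (x, t) ⟨hx, ht'⟩ (z, t) ⟨hz, ht'⟩
      simpa [Prod.dist_eq] using this)
    intervalIntegrable_const
    (by
      filter_upwards [hae] with t ht htab
      exact (hderiv t (ht htab)).1)
  have hz : ∫ t in a..b, 2 * deriv v t = 0 := by
    have h := intervalIntegral.integral_eq_sub_of_hasDerivAt_of_le hab.le
      (f := fun t => 2 * v t) (f' := fun t => 2 * deriv v t) (by fun_prop)
      (fun t ht => (hderiv t ht).2.const_mul 2) hi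
    rw [h, hva, hvb]
    simp
  rwa [hz] at hd

end ParametricIntegral

/-! ### Velocities in charts and the circle generator -/

theorem coordVectorAt_zero (u₀ u : TripleBundle E M) : coordVectorAt u₀ u 0 = 0 :=
  map_zero (mfderiv (tripleModel E) 𝓘(ℝ, E × (R3 →L[ℝ] E)) (extChartAt (tripleModel E) u₀) u)

theorem connectionForm_zero (g : SmoothMetric E M) (u : TripleBundle E M) (i j : Fin 3) :
    connectionForm g u 0 i j = 0 := by
  rw [connectionForm_eq g (mem_extChartAt_source (I := 𝓘(ℝ, E)) u.proj), coordVectorAt_zero]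
  simp [christoffelForm]

/-- The velocity of a curve in the bundle, read in a fixed chart. -/
theorem hasDerivWithinAt_extChartAt_comp {u₀ : TripleBundle E M} {γ : ℝ → TripleBundle E M}
    {s : Set ℝ} {t : ℝ} (hγ : MDifferentiableWithinAt 𝓘(ℝ, ℝ) (tripleModel E) γ s t)
    (hu : (γ t).proj ∈ (extChartAt 𝓘(ℝ, E) u₀.proj).source) :
    HasDerivWithinAt (fun r => extChartAt (tripleModel E) u₀ (γ r))
      (coordVectorAt u₀ (γ t) (mfderivWithin 𝓘(ℝ, ℝ) (tripleModel E) γ s t (1 : ℝ))) s t := by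
  have h1 : HasMFDerivAt (tripleModel E) 𝓘(ℝ, E × (R3 →L[ℝ] E)) (extChartAt (tripleModel E) u₀)
      (γ t) _ := (mdifferentiableAt_extChartAt (mem_chartAt_tripleBundle_source hu)).hasMFDerivAt
  have h2 := h1.comp_hasMFDerivWithinAt t hγ.hasMFDerivWithinAt
  obtain ⟨L, hL⟩ : ∃ L : ℝ →L[ℝ] E × (R3 →L[ℝ] E), L =
      (mfderiv (tripleModel E) 𝓘(ℝ, E × (R3 →L[ℝ] E)) (extChartAt (tripleModel E) u₀) (γ t)).comp
        (mfderivWithin 𝓘(ℝ, ℝ) (tripleModel E) γ s t) := ⟨_, rfl⟩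
  rw [← hL] at h2
  have h3 : HasFDerivWithinAt (fun r => extChartAt (tripleModel E) u₀ (γ r)) L s t :=
    h2.hasFDerivWithinAt
  have h4 := h3.hasDerivWithinAt
  rw [hL] at h4
  exact h4

theorem hasDerivAt_extChartAt_comp {u₀ : TripleBundle E M} {γ : ℝ → TripleBundle E M}
    {t : ℝ} (hγ : MDifferentiableAt 𝓘(ℝ, ℝ) (tripleModel E) γ t)
    (hu : (γ t).proj ∈ (extChartAt 𝓘(ℝ, E) u₀.proj).source) :
    HasDerivAt (fun r => extChartAt (tripleModel E) u₀ (γ r))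
      (coordVectorAt u₀ (γ t) (mfderiv 𝓘(ℝ, ℝ) (tripleModel E) γ t (1 : ℝ))) t := by
  have h := hasDerivWithinAt_extChartAt_comp hγ.mdifferentiableWithinAt hu (s := univ)
  rw [mfderivWithin_univ] at h
  exact h.hasDerivAt univ_mem

/-- Removes the transport in `circleField`, whose flow starts at `u` only propositionally. -/
theorem coordVector_cast {u u' : TripleBundle E M} (h : u' = u)
    (v : TangentSpace (tripleModel E) u') : coordVector u (h ▸ v) = coordVectorAt u u' v := by
  subst h
  rfl

/-- The matrix `Y` generating the circle action, as a linear map. -/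
def rotationGenerator : R3 →L[ℝ] R3 :=
  LinearMap.toContinuousLinearMap (Matrix.toLin' !![0, 1, 0; -1, 0, 0; 0, 0, 0])

/-- Isolating the cosine and sine coefficients reduces differentiation of the flow to scalar
derivatives. -/
theorem rotation_eq (s : ℝ) :
    LinearMap.toContinuousLinearMap (Matrix.toLin' (rotation s)) =
      LinearMap.toContinuousLinearMap (Matrix.toLin' !![0, 0, 0; 0, 0, 0; 0, 0, (1 : ℝ)])
      + Real.cos s • LinearMap.toContinuousLinearMap
        (Matrix.toLin' !![1, 0, 0; 0, 1, 0; 0, 0, (0 : ℝ)])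
      + Real.sin s • rotationGenerator := by
  ext v i
  simp only [rotation, rotationGenerator, LinearMap.coe_toContinuousLinearMap', add_apply,
    smul_apply, Matrix.toLin'_apply, Matrix.mulVec, dotProduct, Fin.sum_univ_three, Pi.add_apply,
    Pi.smul_apply, smul_eq_mul]
  fin_cases i <;> simp
  ring

theorem extChartAt_circleFlow (u : TripleBundle E M) (s : ℝ) :
    extChartAt (tripleModel E) u (circleFlow u s) =
      ((extChartAt (tripleModel E) u u).1, (extChartAt (tripleModel E) u u).2.comp
        (LinearMap.toContinuousLinearMap (Matrix.toLin' (rotation s)))) := by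
  have hp := mem_extChartAt_source (I := 𝓘(ℝ, E)) u.proj
  rw [extChartAt_tripleBundle hp, extChartAt_tripleBundle (u := circleFlow u s) hp]
  rfl

theorem hasDerivAt_extChartAt_circleFlow (u : TripleBundle E M) :
    HasDerivAt (fun s => extChartAt (tripleModel E) u (circleFlow u s))
      (0, (extChartAt (tripleModel E) u u).2.comp rotationGenerator) 0 := by
  simp only [extChartAt_circleFlow, rotation_eq]
  refine (hasDerivAt_const _ _).prodMk ?_
  have h := ((hasDerivAt_const (0 : ℝ) (LinearMap.toContinuousLinearMap
    (Matrix.toLin' !![0, 0, 0; 0, 0, 0; 0, 0, (1 : ℝ)]))).add ((Real.hasDerivAt_cos 0).smul_const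
      (LinearMap.toContinuousLinearMap
        (Matrix.toLin' !![1, 0, 0; 0, 1, 0; 0, 0, (0 : ℝ)])))).add
      ((Real.hasDerivAt_sin 0).smul_const rotationGenerator)
  have h2 := (hasDerivAt_const (0 : ℝ) (extChartAt (tripleModel E) u u).2).clm_comp h
  refine h2.congr_deriv ?_
  simp

theorem mdifferentiableAt_circleFlow (u : TripleBundle E M) :
    MDifferentiableAt 𝓘(ℝ, ℝ) (tripleModel E) (circleFlow u) 0 := by
  rw [mdifferentiableAt_totalSpace]
  refine ⟨mdifferentiableAt_const, ?_⟩
  have h : DifferentiableAt ℝ (fun s => (extChartAt (tripleModel E) u (circleFlow u s)).2) 0 :=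
    (hasDerivAt_extChartAt_circleFlow u).differentiableAt.snd
  exact h.mdifferentiableAt

theorem coordVector_circleField (u : TripleBundle E M) :
    coordVector u (circleField u) =
      (0, (extChartAt (tripleModel E) u u).2.comp rotationGenerator) := by
  rw [circleField, coordVector_cast]
  exact (hasDerivAt_extChartAt_comp (u₀ := u) (mdifferentiableAt_circleFlow u)
    (mem_extChartAt_source (I := 𝓘(ℝ, E)) u.proj)).unique (hasDerivAt_extChartAt_circleFlow u)

theorem metricForm_frame (g : SmoothMetric E M) {o : ManifoldOrientation E M}
    {u₀ u : TripleBundle E M} (hu : u.proj ∈ (extChartAt 𝓘(ℝ, E) u₀.proj).source)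
    (hP : u ∈ frameBundle g o) (i j : Fin 3) :
    metricForm g u₀.proj (extChartAt (tripleModel E) u₀ u).1
      ((extChartAt (tripleModel E) u₀ u).2 (stdVec i))
      ((extChartAt (tripleModel E) u₀ u).2 (stdVec j)) = if i = j then 1 else 0 := by
  rw [extChartAt_tripleBundle hu, ← hP.1 i j]
  exact metricForm_chartDeriv g hu _ _

theorem canonicalForm_circleField (g : SmoothMetric E M) (u : TripleBundle E M) (i : Fin 3) :
    canonicalForm g u (circleField u) i = 0 := by
  rw [canonicalForm_eq g (mem_extChartAt_source (I := 𝓘(ℝ, E)) u.proj),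
    show coordVectorAt u u (circleField u) = _ from coordVector_circleField u]
  simp

theorem rotationGenerator_stdVec_zero : rotationGenerator (stdVec 0) = -stdVec 1 := by
  ext i
  fin_cases i <;> simp [rotationGenerator, stdVec]

theorem rotationGenerator_stdVec_one : rotationGenerator (stdVec 1) = stdVec 0 := by
  ext i
  fin_cases i <;> simp [rotationGenerator, stdVec]

theorem rotationGenerator_stdVec_two : rotationGenerator (stdVec 2) = 0 := by
  ext i
  fin_cases i <;> simp [rotationGenerator, stdVec]

theorem connectionForm_circleField (g : SmoothMetric E M) (u : TripleBundle E M) (i j : Fin 3) :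
    connectionForm g u (circleField u) i j = metricForm g u.proj (extChartAt (tripleModel E) u u).1
      ((extChartAt (tripleModel E) u u).2 (stdVec i))
      ((extChartAt (tripleModel E) u u).2 (rotationGenerator (stdVec j))) := by
  rw [connectionForm_eq g (mem_extChartAt_source (I := 𝓘(ℝ, E)) u.proj),
    show coordVectorAt u u (circleField u) = _ from coordVector_circleField u]
  simp [christoffelForm]

/-- On the frame bundle the Fefferman metric pairs the circle generator with a vector to the third
component of the canonical form. -/
theorem feffermanMetric_circleField (g : SmoothMetric E M) {o : ManifoldOrientation E M}
    {u : TripleBundle E M} (hP : u ∈ frameBundle g o) (v : TangentSpace (tripleModel E) u) :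
    feffermanMetric g u (circleField u) v = canonicalForm g u v 2 := by
  have hon := metricForm_frame g (mem_extChartAt_source (I := 𝓘(ℝ, E)) u.proj) hP
  simp only [feffermanMetric, canonicalForm_circleField, connectionComp, Fin.sum_univ_three,
    connectionForm_circleField, Matrix.cons_val, rotationGenerator_stdVec_zero,
    rotationGenerator_stdVec_one, rotationGenerator_stdVec_two, map_zero, map_neg, hon]
  simp

/-! ### Partial derivatives of a variation in a chart -/

section Variation

variable {a b δ : ℝ} {Γ : ℝ → ℝ → TripleBundle E M}

/-- A family of curves in the bundle, read in the preferred chart at `u₀`. -/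
def chartFamily (Γ : ℝ → ℝ → TripleBundle E M) (u₀ : TripleBundle E M) (p : ℝ × ℝ) :
    E × (R3 →L[ℝ] E) :=
  extChartAt (tripleModel E) u₀ (Γ p.1 p.2)

theorem uniqueDiffOn_strip (hab : a < b) :
    UniqueDiffOn ℝ (Ioo (-δ) δ ×ˢ Icc a b) :=
  isOpen_Ioo.uniqueDiffOn.prod (uniqueDiffOn_Icc hab)

theorem eventually_family_mem_source
    (hΓ : ContMDiffOn 𝓘(ℝ, ℝ × ℝ) (tripleModel E) ∞ (fun q : ℝ × ℝ => Γ q.1 q.2)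
      (Ioo (-δ) δ ×ˢ Icc a b)) {p : ℝ × ℝ} (hp : p ∈ Ioo (-δ) δ ×ˢ Icc a b) :
    ∀ᶠ q in 𝓝[Ioo (-δ) δ ×ˢ Icc a b] p,
      (Γ q.1 q.2).proj ∈ (extChartAt 𝓘(ℝ, E) (Γ p.1 p.2).proj).source :=
  (hΓ.continuousOn p hp).eventually
    (eventually_mem_source (mem_extChartAt_source (I := 𝓘(ℝ, E)) (Γ p.1 p.2).proj))

theorem contDiffWithinAt_chartFamily
    (hΓ : ContMDiffOn 𝓘(ℝ, ℝ × ℝ) (tripleModel E) ∞ (fun q : ℝ × ℝ => Γ q.1 q.2)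
      (Ioo (-δ) δ ×ˢ Icc a b)) {p : ℝ × ℝ} (hp : p ∈ Ioo (-δ) δ ×ˢ Icc a b)
    {u₀ : TripleBundle E M} (hu : (Γ p.1 p.2).proj ∈ (extChartAt 𝓘(ℝ, E) u₀.proj).source) :
    ContDiffWithinAt ℝ ∞ (chartFamily Γ u₀) (Ioo (-δ) δ ×ˢ Icc a b) p := by
  rw [← contMDiffWithinAt_iff_contDiffWithinAt]
  exact (contMDiffAt_extChartAt' (I := tripleModel E) (n := ∞) (x := u₀)
    (mem_chartAt_tripleBundle_source hu)).comp_contMDiffWithinAt p (hΓ p hp)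

theorem coordVectorAt_frameVelocity (hab : a < b)
    (hΓ : ContMDiffOn 𝓘(ℝ, ℝ × ℝ) (tripleModel E) ∞ (fun q : ℝ × ℝ => Γ q.1 q.2)
      (Ioo (-δ) δ ×ˢ Icc a b)) {p : ℝ × ℝ} (hp : p ∈ Ioo (-δ) δ ×ˢ Icc a b)
    {u₀ : TripleBundle E M} (hu : (Γ p.1 p.2).proj ∈ (extChartAt 𝓘(ℝ, E) u₀.proj).source) :
    coordVectorAt u₀ (Γ p.1 p.2) (frameVelocity a b (Γ p.1) p.2) =
      fderivWithin ℝ (chartFamily Γ u₀) (Ioo (-δ) δ ×ˢ Icc a b) p (0, 1) := by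
  have hmaps : MapsTo (fun t : ℝ => (p.1, t)) (Icc a b) (Ioo (-δ) δ ×ˢ Icc a b) :=
    fun t ht => ⟨hp.1, ht⟩
  have hd := ((contDiffWithinAt_chartFamily hΓ hp hu).differentiableWithinAt
    (by simp)).hasFDerivWithinAt
  have h1 := hd.comp_hasDerivWithinAt (f := fun t : ℝ => (p.1, t)) p.2
    ((hasDerivWithinAt_const p.2 _ p.1).prodMk (hasDerivWithinAt_id p.2 _)) hmaps
  have hm : MDifferentiableWithinAt 𝓘(ℝ, ℝ) (tripleModel E) (Γ p.1) (Icc a b) p.2 := by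
    have hι : ContMDiffWithinAt 𝓘(ℝ, ℝ) 𝓘(ℝ, ℝ × ℝ) ∞ (fun t : ℝ => (p.1, t)) (Icc a b) p.2 :=
      contMDiffWithinAt_iff_contDiffWithinAt.2 (by fun_prop)
    exact ((hΓ p hp).comp (f := fun t : ℝ => (p.1, t)) p.2 hι hmaps).mdifferentiableWithinAt
      (by simp)
  exact (uniqueDiffOn_Icc hab _ hp.2).eq_deriv _ (hasDerivWithinAt_extChartAt_comp hm hu) h1

theorem coordVectorAt_variationField (hδ : 0 < δ)
    (hΓ : ContMDiffOn 𝓘(ℝ, ℝ × ℝ) (tripleModel E) ∞ (fun q : ℝ × ℝ => Γ q.1 q.2)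
      (Ioo (-δ) δ ×ˢ Icc a b)) {t : ℝ} (ht : t ∈ Icc a b)
    {u₀ : TripleBundle E M} (hu : (Γ 0 t).proj ∈ (extChartAt 𝓘(ℝ, E) u₀.proj).source) :
    coordVectorAt u₀ (Γ 0 t) (variationField Γ t) =
      fderivWithin ℝ (chartFamily Γ u₀) (Ioo (-δ) δ ×ˢ Icc a b) (0, t) (1, 0) := by
  have h0 : (0 : ℝ) ∈ Ioo (-δ) δ := ⟨by linarith, hδ⟩
  have hn : Ioo (-δ) δ ∈ 𝓝 (0 : ℝ) := isOpen_Ioo.mem_nhds h0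
  have hmaps : MapsTo (fun ε : ℝ => (ε, t)) (Ioo (-δ) δ) (Ioo (-δ) δ ×ˢ Icc a b) :=
    fun ε hε => ⟨hε, ht⟩
  have hd := ((contDiffWithinAt_chartFamily hΓ (p := (0, t)) ⟨h0, ht⟩ hu).differentiableWithinAt
    (by simp)).hasFDerivWithinAt
  have h1 := (hd.comp_hasDerivWithinAt (f := fun ε : ℝ => (ε, t)) 0
    ((hasDerivWithinAt_id 0 _).prodMk (hasDerivWithinAt_const 0 _ t)) hmaps).hasDerivAt hn
  have hm : MDifferentiableAt 𝓘(ℝ, ℝ) (tripleModel E) (fun ε => Γ ε t) 0 := by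
    have hι : ContMDiffWithinAt 𝓘(ℝ, ℝ) 𝓘(ℝ, ℝ × ℝ) ∞ (fun ε : ℝ => (ε, t)) (Ioo (-δ) δ) 0 :=
      contMDiffWithinAt_iff_contDiffWithinAt.2 (by fun_prop)
    exact (((hΓ (0, t) ⟨h0, ht⟩).comp (f := fun ε : ℝ => (ε, t)) 0 hι hmaps).contMDiffAt
      hn).mdifferentiableAt (by simp)
  exact (hasDerivAt_extChartAt_comp (γ := fun ε => Γ ε t) hm hu).unique h1

end Variation

/-! ### Regularity of φ and ω along a variation -/

section Smoothness

variable {a b δ : ℝ} {Γ : ℝ → ℝ → TripleBundle E M}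

/-- The value of the canonical form on the partial derivative of a family in the direction `e`, in
the preferred chart at `u₀`. -/
def chartCanonical (g : SmoothMetric E M) (Γ : ℝ → ℝ → TripleBundle E M) (S : Set (ℝ × ℝ))
    (u₀ : TripleBundle E M) (e : ℝ × ℝ) (i : Fin 3) (p : ℝ × ℝ) : ℝ :=
  metricForm g u₀.proj (chartFamily Γ u₀ p).1 ((chartFamily Γ u₀ p).2 (stdVec i))
    (fderivWithin ℝ (chartFamily Γ u₀) S p e).1

/-- The value of the connection form on the partial derivative of a family in the direction `e`, in
the preferred chart at `u₀`. -/
def chartConnection (g : SmoothMetric E M) (Γ : ℝ → ℝ → TripleBundle E M) (S : Set (ℝ × ℝ))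
    (u₀ : TripleBundle E M) (e : ℝ × ℝ) (i j : Fin 3) (p : ℝ × ℝ) : ℝ :=
  metricForm g u₀.proj (chartFamily Γ u₀ p).1 ((chartFamily Γ u₀ p).2 (stdVec i))
      ((fderivWithin ℝ (chartFamily Γ u₀) S p e).2 (stdVec j))
    + christoffelForm (metricForm g u₀.proj) (chartFamily Γ u₀ p).1
      (fderivWithin ℝ (chartFamily Γ u₀) S p e).1 ((chartFamily Γ u₀ p).2 (stdVec j))
      ((chartFamily Γ u₀ p).2 (stdVec i))

theorem chartFamily_fst_mem_target {u₀ : TripleBundle E M} {p : ℝ × ℝ}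
    (hu : (Γ p.1 p.2).proj ∈ (extChartAt 𝓘(ℝ, E) u₀.proj).source) :
    (chartFamily Γ u₀ p).1 ∈ (extChartAt 𝓘(ℝ, E) u₀.proj).target := by
  rw [chartFamily, extChartAt_tripleBundle hu]
  exact (extChartAt 𝓘(ℝ, E) u₀.proj).map_source hu

theorem _root_.ContDiffWithinAt.clm_apply_const {F G V : Type*} [NormedAddCommGroup F]
    [NormedSpace ℝ F] [NormedAddCommGroup G] [NormedSpace ℝ G] [NormedAddCommGroup V]
    [NormedSpace ℝ V] {n : ℕ∞ω} {f : V → F →L[ℝ] G} {s : Set V} {x : V}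
    (hf : ContDiffWithinAt ℝ n f s x) (c : F) : ContDiffWithinAt ℝ n (fun y => f y c) s x :=
  hf.clm_apply contDiffWithinAt_const

theorem contDiffWithinAt_chartCanonical (g : SmoothMetric E M) (hab : a < b)
    (hΓ : ContMDiffOn 𝓘(ℝ, ℝ × ℝ) (tripleModel E) ∞ (fun q : ℝ × ℝ => Γ q.1 q.2)
      (Ioo (-δ) δ ×ˢ Icc a b)) {p : ℝ × ℝ} (hp : p ∈ Ioo (-δ) δ ×ˢ Icc a b)
    {u₀ : TripleBundle E M} (hu : (Γ p.1 p.2).proj ∈ (extChartAt 𝓘(ℝ, E) u₀.proj).source)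
    (e : ℝ × ℝ) (i : Fin 3) :
    ContDiffWithinAt ℝ 1 (chartCanonical g Γ (Ioo (-δ) δ ×ˢ Icc a b) u₀ e i)
      (Ioo (-δ) δ ×ˢ Icc a b) p := by
  have hΨ := contDiffWithinAt_chartFamily hΓ hp hu
  have hD := (hΨ.fderivWithin_right (m := 1) (uniqueDiffOn_strip hab) (by norm_cast)
    hp).clm_apply_const e
  have hΨ1 : ContDiffWithinAt ℝ 1 (chartFamily Γ u₀) _ p := hΨ.of_le (by norm_cast)
  have hH := ((contDiffAt_metricForm g (chartFamily_fst_mem_target hu)).of_le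
    (by norm_cast : (1 : ℕ∞ω) ≤ ∞)).comp_contDiffWithinAt p hΨ1.fst
  exact (hH.clm_apply (hΨ1.snd.clm_apply_const _)).clm_apply hD.fst

theorem contDiffWithinAt_chartConnection (g : SmoothMetric E M) (hab : a < b)
    (hΓ : ContMDiffOn 𝓘(ℝ, ℝ × ℝ) (tripleModel E) ∞ (fun q : ℝ × ℝ => Γ q.1 q.2)
      (Ioo (-δ) δ ×ˢ Icc a b)) {p : ℝ × ℝ} (hp : p ∈ Ioo (-δ) δ ×ˢ Icc a b)
    {u₀ : TripleBundle E M} (hu : (Γ p.1 p.2).proj ∈ (extChartAt 𝓘(ℝ, E) u₀.proj).source)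
    (e : ℝ × ℝ) (i j : Fin 3) :
    ContDiffWithinAt ℝ 1 (chartConnection g Γ (Ioo (-δ) δ ×ˢ Icc a b) u₀ e i j)
      (Ioo (-δ) δ ×ˢ Icc a b) p := by
  have hΨ := contDiffWithinAt_chartFamily hΓ hp hu
  have hD := (hΨ.fderivWithin_right (m := 1) (uniqueDiffOn_strip hab) (by norm_cast)
    hp).clm_apply_const e
  have hΨ1 : ContDiffWithinAt ℝ 1 (chartFamily Γ u₀) _ p := hΨ.of_le (by norm_cast)
  have hm := contDiffAt_metricForm g (chartFamily_fst_mem_target hu)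
  have hH := (hm.of_le (by norm_cast : (1 : ℕ∞ω) ≤ ∞)).comp_contDiffWithinAt p hΨ1.fst
  have hdH := (hm.fderiv_right (m := 1) (by norm_cast)).comp_contDiffWithinAt p hΨ1.fst
  have hC := fun k => hΨ1.snd.clm_apply_const (stdVec k)
  refine ((hH.clm_apply (hC i)).clm_apply (hD.snd.clm_apply_const _)).add
    (ContDiffWithinAt.div_const
    (((((hdH.clm_apply hD.fst).clm_apply (hC j)).clm_apply (hC i)).add
      (((hdH.clm_apply (hC j)).clm_apply hD.fst).clm_apply (hC i))).sub
      (((hdH.clm_apply (hC i)).clm_apply hD.fst).clm_apply (hC j))) 2)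

theorem canonicalForm_frameVelocity (g : SmoothMetric E M) (hab : a < b)
    (hΓ : ContMDiffOn 𝓘(ℝ, ℝ × ℝ) (tripleModel E) ∞ (fun q : ℝ × ℝ => Γ q.1 q.2)
      (Ioo (-δ) δ ×ˢ Icc a b)) {p : ℝ × ℝ} (hp : p ∈ Ioo (-δ) δ ×ˢ Icc a b)
    {u₀ : TripleBundle E M} (hu : (Γ p.1 p.2).proj ∈ (extChartAt 𝓘(ℝ, E) u₀.proj).source)
    (i : Fin 3) :
    canonicalForm g (Γ p.1 p.2) (frameVelocity a b (Γ p.1) p.2) i =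
      chartCanonical g Γ (Ioo (-δ) δ ×ˢ Icc a b) u₀ (0, 1) i p := by
  rw [canonicalForm_eq g hu, coordVectorAt_frameVelocity hab hΓ hp hu]
  rfl

theorem connectionForm_frameVelocity (g : SmoothMetric E M) (hab : a < b)
    (hΓ : ContMDiffOn 𝓘(ℝ, ℝ × ℝ) (tripleModel E) ∞ (fun q : ℝ × ℝ => Γ q.1 q.2)
      (Ioo (-δ) δ ×ˢ Icc a b)) {p : ℝ × ℝ} (hp : p ∈ Ioo (-δ) δ ×ˢ Icc a b)
    {u₀ : TripleBundle E M} (hu : (Γ p.1 p.2).proj ∈ (extChartAt 𝓘(ℝ, E) u₀.proj).source)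
    (i j : Fin 3) :
    connectionForm g (Γ p.1 p.2) (frameVelocity a b (Γ p.1) p.2) i j =
      chartConnection g Γ (Ioo (-δ) δ ×ˢ Icc a b) u₀ (0, 1) i j p := by
  rw [connectionForm_eq g hu, coordVectorAt_frameVelocity hab hΓ hp hu]
  rfl

theorem connectionForm_variationField (g : SmoothMetric E M) (hδ : 0 < δ)
    (hΓ : ContMDiffOn 𝓘(ℝ, ℝ × ℝ) (tripleModel E) ∞ (fun q : ℝ × ℝ => Γ q.1 q.2)
      (Ioo (-δ) δ ×ˢ Icc a b)) {t : ℝ} (ht : t ∈ Icc a b)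
    {u₀ : TripleBundle E M} (hu : (Γ 0 t).proj ∈ (extChartAt 𝓘(ℝ, E) u₀.proj).source)
    (i j : Fin 3) :
    connectionForm g (Γ 0 t) (variationField Γ t) i j =
      chartConnection g Γ (Ioo (-δ) δ ×ˢ Icc a b) u₀ (1, 0) i j (0, t) := by
  rw [connectionForm_eq g hu, coordVectorAt_variationField hδ hΓ ht hu]
  rfl

theorem contDiffOn_canonicalForm (g : SmoothMetric E M) (hab : a < b)
    (hΓ : ContMDiffOn 𝓘(ℝ, ℝ × ℝ) (tripleModel E) ∞ (fun q : ℝ × ℝ => Γ q.1 q.2)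
      (Ioo (-δ) δ ×ˢ Icc a b)) (i : Fin 3) :
    ContDiffOn ℝ 1 (fun p : ℝ × ℝ =>
      canonicalForm g (Γ p.1 p.2) (frameVelocity a b (Γ p.1) p.2) i)
      (Ioo (-δ) δ ×ˢ Icc a b) := by
  intro p hp
  have hu := mem_extChartAt_source (I := 𝓘(ℝ, E)) (Γ p.1 p.2).proj
  refine (contDiffWithinAt_chartCanonical g hab hΓ hp hu (0, 1) i).congr_of_eventuallyEq_of_mem
    ?_ hp
  filter_upwards [eventually_family_mem_source hΓ hp, self_mem_nhdsWithin] with q hq hqS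
  exact canonicalForm_frameVelocity g hab hΓ hqS hq i

theorem contDiffOn_connectionForm (g : SmoothMetric E M) (hab : a < b)
    (hΓ : ContMDiffOn 𝓘(ℝ, ℝ × ℝ) (tripleModel E) ∞ (fun q : ℝ × ℝ => Γ q.1 q.2)
      (Ioo (-δ) δ ×ˢ Icc a b)) (i j : Fin 3) :
    ContDiffOn ℝ 1 (fun p : ℝ × ℝ =>
      connectionForm g (Γ p.1 p.2) (frameVelocity a b (Γ p.1) p.2) i j)
      (Ioo (-δ) δ ×ˢ Icc a b) := by
  intro p hp
  have hu := mem_extChartAt_source (I := 𝓘(ℝ, E)) (Γ p.1 p.2).proj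
  refine (contDiffWithinAt_chartConnection g hab hΓ hp hu (0, 1) i j).congr_of_eventuallyEq_of_mem
    ?_ hp
  filter_upwards [eventually_family_mem_source hΓ hp, self_mem_nhdsWithin] with q hq hqS
  exact connectionForm_frameVelocity g hab hΓ hqS hq i j

/-- Continuity up to the endpoints lets the boundary values of v₀₁ enter the fundamental theorem of
calculus, although its derivative is computed only inside. -/
theorem continuousOn_connectionForm_variationField (g : SmoothMetric E M) (hδ : 0 < δ)
    (hab : a < b)
    (hΓ : ContMDiffOn 𝓘(ℝ, ℝ × ℝ) (tripleModel E) ∞ (fun q : ℝ × ℝ => Γ q.1 q.2)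
      (Ioo (-δ) δ ×ˢ Icc a b)) (i j : Fin 3) :
    ContinuousOn (fun t => connectionForm g (Γ 0 t) (variationField Γ t) i j) (Icc a b) := by
  intro t ht
  have hp : ((0 : ℝ), t) ∈ Ioo (-δ) δ ×ˢ Icc a b := ⟨⟨by linarith, hδ⟩, ht⟩
  have hu := mem_extChartAt_source (I := 𝓘(ℝ, E)) (Γ 0 t).proj
  have hι : Tendsto (fun r : ℝ => ((0 : ℝ), r)) (𝓝[Icc a b] t)
      (𝓝[Ioo (-δ) δ ×ˢ Icc a b] (0, t)) := by
    refine ContinuousWithinAt.tendsto_nhdsWithin (f := fun r : ℝ => ((0 : ℝ), r)) (by fun_prop) ?_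
    exact fun r hr => ⟨⟨by linarith, hδ⟩, hr⟩
  have h1 := (contDiffWithinAt_chartConnection g hab hΓ hp hu (1, 0) i j).continuousWithinAt
  have h2 : ContinuousWithinAt (fun r => chartConnection g Γ (Ioo (-δ) δ ×ˢ Icc a b) (Γ 0 t)
    (1, 0) i j (0, r)) (Icc a b) t := h1.tendsto.comp hι
  refine h2.congr_of_eventuallyEq_of_mem ?_ ht
  filter_upwards [hι.eventually (eventually_family_mem_source hΓ hp), self_mem_nhdsWithin]
    with r hr hrI
  exact connectionForm_variationField g hδ hΓ hrI hr i j

end Smoothness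

/-! ### Lifts of the tangent direction -/

section Lift

variable {a b : ℝ}

/-- A tangent vector as an element of the model space. -/
def tangentModel (v : TangentBundle 𝓘(ℝ, E) M) : E := v.snd

/-- A lift of a regular curve whose third frame vector is the unit tangent has base velocity a
nonzero multiple of that vector. -/
theorem exists_projDeriv_frameVelocity_eq (g : SmoothMetric E M) (hab : a < b) {x : ℝ → M}
    (hx : IsRegularCurve E a b x) {γ : ℝ → TripleBundle E M}
    (hγ : MDifferentiableOn 𝓘(ℝ, ℝ) (tripleModel E) γ (Icc a b))
    (hγx : ∀ t ∈ Icc a b, sphereProj (γ t) = tangentLift g a b x t) {t : ℝ} (ht : t ∈ Icc a b) :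
    ∃ f : ℝ, f ≠ 0 ∧
      (projDeriv (γ t) (frameVelocity a b γ t) : E) = f • (frameVec (γ t) 2 : E) := by
  have hproj : ∀ s ∈ Icc a b, (γ s).proj = x s := fun s hs =>
    congrArg (TotalSpace.proj (F := E)) (hγx s hs)
  set V : E := baseVelocity E a b x t with hV
  have hvec : (frameVec (γ t) 2 : E) = (√(innerModel g (x t) V V))⁻¹ • V :=
    congrArg tangentModel (hγx t ht)
  have hpos : 0 < innerModel g (x t) V V := g.pos (x t) (baseVelocity E a b x t) (hx.2 t ht)
  have hne : √(innerModel g (x t) V V) ≠ 0 := (Real.sqrt_pos.2 hpos).ne'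
  refine ⟨√(innerModel g (x t) V V), hne, ?_⟩
  have hscale : ∀ (r : ℝ) (w : E), r ≠ 0 → w = r⁻¹ • V → V = r • w := by
    rintro r w hr rfl
    rw [smul_smul, mul_inv_cancel₀ hr, one_smul]
  have h1 := mfderiv_comp_mfderivWithin t (mdifferentiableAt_proj (γ t)) (hγ t ht)
    (uniqueMDiffOn_iff_uniqueDiffOn.2 (uniqueDiffOn_Icc hab) t ht)
  have h2 : mfderivWithin 𝓘(ℝ, ℝ) 𝓘(ℝ, E) ((fun w : TripleBundle E M => w.proj) ∘ γ) (Icc a b) t =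
      mfderivWithin 𝓘(ℝ, ℝ) 𝓘(ℝ, E) x (Icc a b) t :=
    mfderivWithin_congr (fun s hs => hproj s hs) (hproj t ht)
  exact Eq.trans (DFunLike.congr_fun (h1.symm.trans h2) (1 : ℝ)) (hscale _ _ hne hvec)

theorem canonicalForm_two_of_projDeriv_eq (g : SmoothMetric E M) {o : ManifoldOrientation E M}
    {u : TripleBundle E M} (hP : u ∈ frameBundle g o) {v : TangentSpace (tripleModel E) u} {f : ℝ}
    (hv : (projDeriv u v : E) = f • (frameVec u 2 : E)) : canonicalForm g u v 2 = f := by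
  have h1 : innerModel g u.proj (frameVec u 2) (frameVec u 2) = 1 := hP.1 2 2
  have h2 : canonicalForm g u v 2 = innerModel g u.proj (frameVec u 2) (projDeriv u v) := rfl
  rw [h2, hv]
  refine (map_smul (innerModel g u.proj (frameVec u 2)) f _).trans ?_
  rw [h1, smul_eq_mul, mul_one]

end Lift

/-! ### The first variation on the frame bundle -/

section FirstVariation

variable {a b δ : ℝ} {γ : ℝ → TripleBundle E M} {Γ : ℝ → ℝ → TripleBundle E M}

/-- The local computation applied in the chart at `Γ 0 t`. Since `t` is interior, the strip is a
neighbourhood of `(0, t)` and derivatives within it are ordinary ones. -/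
theorem exists_hasDerivAt_variation (hE : Module.finrank ℝ E = 3) {g : SmoothMetric E M}
    {o : ManifoldOrientation E M} (hδ : 0 < δ) (hab : a < b) (hΓ : IsVariation g o a b δ γ Γ)
    (hvert : ∀ t ∈ Icc a b, projDeriv (Γ 0 t) (variationField Γ t) = 0)
    {t f : ℝ} (ht : t ∈ Ioo a b) (hf : f ≠ 0)
    (hT : (projDeriv (Γ 0 t) (frameVelocity a b (Γ 0) t) : E) = f • (frameVec (Γ 0 t) 2 : E))
    {φ : Fin 3 → ℝ × ℝ → ℝ} {κ : Fin 3 → Fin 3 → ℝ × ℝ → ℝ}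
    (hφ : ∀ i p, φ i p = canonicalForm g (Γ p.1 p.2) (frameVelocity a b (Γ p.1) p.2) i)
    (hκ : ∀ i j p, κ i j p = connectionForm g (Γ p.1 p.2) (frameVelocity a b (Γ p.1) p.2) i j) :
    ∃ c, HasDerivAt (fun ε => 2 * (φ 0 (ε, t) * κ 1 2 (ε, t) + φ 1 (ε, t) * κ 2 0 (ε, t)
        + φ 2 (ε, t) * κ 0 1 (ε, t)) / φ 2 (ε, t)) (2 * c) 0 ∧
      HasDerivAt (fun r => connectionForm g (Γ 0 r) (variationField Γ r) 0 1) c t := by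
  set S : Set (ℝ × ℝ) := Ioo (-δ) δ ×ˢ Icc a b with hS
  set u₀ := Γ 0 t with hu₀
  set Ψ := chartFamily Γ u₀ with hΨ
  have hsm := hΓ.smooth
  have ht' := Ioo_subset_Icc_self ht
  have hp : ((0 : ℝ), t) ∈ S := ⟨⟨by linarith, hδ⟩, ht'⟩
  have hO : IsOpen (Ioo (-δ) δ ×ˢ Ioo a b) := isOpen_Ioo.prod isOpen_Ioo
  have hSn : ∀ᶠ p in 𝓝 ((0 : ℝ), t), S ∈ 𝓝 p := by
    filter_upwards [hO.mem_nhds (⟨⟨by linarith, hδ⟩, ht⟩ : ((0 : ℝ), t) ∈ Ioo (-δ) δ ×ˢ Ioo a b)]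
      with p hp
    exact mem_of_superset (hO.mem_nhds hp) (prod_mono_right Ioo_subset_Icc_self)
  have hmem : ∀ᶠ p in 𝓝 ((0 : ℝ), t), p ∈ S ∧
      (Γ p.1 p.2).proj ∈ (extChartAt 𝓘(ℝ, E) u₀.proj).source := by
    have h := eventually_family_mem_source hsm hp
    rw [nhdsWithin_eq_nhds.2 hSn.self_of_nhds] at h
    exact Filter.Eventually.and hSn.self_of_nhds h
  have htcont : ContinuousAt (fun r : ℝ => ((0 : ℝ), r)) t := by fun_prop
  have hΨd : ∀ p, S ∈ 𝓝 p → p ∈ S → (Γ p.1 p.2).proj ∈ (extChartAt 𝓘(ℝ, E) u₀.proj).source →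
      ContDiffAt ℝ ∞ Ψ p := fun p h1 h2 h3 => (contDiffWithinAt_chartFamily hsm h2 h3).contDiffAt h1
  have hΨ0 : ContDiffAt ℝ 2 Ψ (0, t) :=
    (hΨd _ hSn.self_of_nhds hp hmem.self_of_nhds.2).of_le (by norm_cast)
  have hD : ∀ᶠ p in 𝓝 ((0 : ℝ), t), ∀ e,
      fderiv ℝ (fun q => (Ψ q).1) p e = (fderivWithin ℝ Ψ S p e).1 ∧
      ∀ i, fderiv ℝ (fun q => (Ψ q).2 (stdVec i)) p e =
        (fderivWithin ℝ Ψ S p e).2 (stdVec i) := by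
    filter_upwards [hSn, hmem] with p h1 h2 e
    have h3 := ((hΨd p h1 h2.1 h2.2).differentiableAt (by simp)).hasFDerivAt
    rw [fderivWithin_of_mem_nhds h1]
    refine ⟨?_, fun i => ?_⟩
    · rw [h3.fst.fderiv]
      rfl
    · rw [(h3.snd.clm_apply (hasFDerivAt_const (stdVec i) p)).fderiv]
      simp
  obtain ⟨c, hc1, hc2⟩ := exists_hasDerivAt_kropina (H := metricForm g u₀.proj)
    (Y := fun q => (Ψ q).1) (C := fun i q => (Ψ q).2 (stdVec i)) (t := t) (f := f) (φ := φ) (κ := κ)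
    hE (metricForm_symm g u₀.proj)
    ((contDiffAt_metricForm g (chartFamily_fst_mem_target hmem.self_of_nhds.2)).of_le
      (by norm_cast))
    hΨ0.fst (fun i => hΨ0.snd.clm_apply contDiffAt_const)
    (by
      filter_upwards [hmem] with p hp i j
      exact metricForm_frame g hp.2 (hΓ.mem p.1 hp.1.1 p.2 hp.1.2) i j)
    (by
      filter_upwards [htcont.eventually hmem, htcont.eventually hD] with r hr hDr
      rw [(hDr _).1, ← coordVectorAt_variationField hδ hsm hr.1.2 hr.2, coordVectorAt_fst hr.2,
        hvert r hr.1.2]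
      exact map_zero (chartDeriv E u₀.proj (Γ 0 r).proj))
    hf
    (by
      rw [(hD.self_of_nhds _).1, ← coordVectorAt_frameVelocity hab hsm hp hmem.self_of_nhds.2,
        coordVectorAt_fst hmem.self_of_nhds.2, hT]
      refine (map_smul (chartDeriv E u₀.proj u₀.proj) f _).trans ?_
      rw [hΨ, chartFamily, extChartAt_tripleBundle hmem.self_of_nhds.2]
      rfl)
    (by
      intro i
      filter_upwards [hmem, hD] with p hp hDp
      rw [hφ, canonicalForm_frameVelocity g hab hsm hp.1 hp.2, (hDp _).1]
      rfl)
    (by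
      intro i j
      filter_upwards [hmem, hD] with p hp hDp
      rw [hκ, connectionForm_frameVelocity g hab hsm hp.1 hp.2, (hDp _).1, (hDp _).2 j]
      rfl)
  refine ⟨c, hc1, hc2.congr_of_eventuallyEq ?_⟩
  filter_upwards [htcont.eventually hmem, htcont.eventually hD] with r hr hDr
  -- Verticality removes the Christoffel term, so ω₀₁ of the variation field is the quantity
  -- differentiated in the local lemma.
  have h0 : (coordVectorAt u₀ (Γ 0 r) (variationField Γ r)).1 = 0 := by
    rw [coordVectorAt_fst hr.2, hvert r hr.1.2]
    exact map_zero (chartDeriv E u₀.proj (Γ 0 r).proj)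
  rw [connectionForm_eq g hr.2, h0, (hDr _).2,
    coordVectorAt_variationField hδ hsm hr.1.2 hr.2]
  simp [christoffelForm]
  rfl

end FirstVariation

end FeffermanFrame

end

open FeffermanFrame in
theorem proposition5p6 {E : Type*} [NormedAddCommGroup E] [NormedSpace ℝ E]
    (hE : Module.finrank ℝ E = 3)
    {M : Type*} [TopologicalSpace M] [T2Space M] [SecondCountableTopology M]
    [ChartedSpace E M] [IsManifold 𝓘(ℝ, E) ∞ M]
    (g : SmoothMetric E M) (o : ManifoldOrientation E M)
    (a b : ℝ) (hab : a < b)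
    (x : ℝ → M) (hx : IsRegularCurve E a b x)
    (γ : ℝ → TripleBundle E M)
    (hγ : ContMDiffOn 𝓘(ℝ, ℝ) (tripleModel E) ∞ γ (Icc a b))
    (hγP : ∀ t ∈ Icc a b, γ t ∈ frameBundle g o)
    (hγx : ∀ t ∈ Icc a b, sphereProj (γ t) = tangentLift g a b x t)
    (δ : ℝ) (hδ : 0 < δ) (Γ : ℝ → ℝ → TripleBundle E M)
    (hΓ : IsVariation g o a b δ γ Γ)
    (hvert : ∀ t ∈ Icc a b, projDeriv (Γ 0 t) (variationField Γ t) = 0) :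
    (∀ᶠ ε in 𝓝 (0 : ℝ), (∀ t ∈ Icc a b, kropinaDenom g a b (Γ ε) t ≠ 0) ∧
      IntervalIntegrable (kropinaIntegrand g a b (Γ ε)) volume a b) ∧
    HasDerivAt (fun ε : ℝ => ∫ t in a..b, kropinaIntegrand g a b (Γ ε) t) 0 0 := by
  have hsm := hΓ.smooth
  have h0δ : (0 : ℝ) ∈ Ioo (-δ) δ := ⟨by linarith, hδ⟩
  obtain ⟨φ, hφ⟩ : ∃ φ : Fin 3 → ℝ × ℝ → ℝ, ∀ i p, φ i p =
    canonicalForm g (Γ p.1 p.2) (frameVelocity a b (Γ p.1) p.2) i := ⟨_, fun _ _ => rfl⟩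
  obtain ⟨κ, hκ⟩ : ∃ κ : Fin 3 → Fin 3 → ℝ × ℝ → ℝ, ∀ i j p, κ i j p =
    connectionForm g (Γ p.1 p.2) (frameVelocity a b (Γ p.1) p.2) i j := ⟨_, fun _ _ _ => rfl⟩
  have hφs : ∀ i, ContDiffOn ℝ 1 (φ i) (Ioo (-δ) δ ×ˢ Icc a b) := fun i =>
    (contDiffOn_canonicalForm g hab hsm i).congr fun p _ => hφ i p
  have hκs : ∀ i j, ContDiffOn ℝ 1 (κ i j) (Ioo (-δ) δ ×ˢ Icc a b) := fun i j =>
    (contDiffOn_connectionForm g hab hsm i j).congr fun p _ => hκ i j p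
  have hden : ∀ ε ∈ Ioo (-δ) δ, ∀ t ∈ Icc a b, kropinaDenom g a b (Γ ε) t = φ 2 (ε, t) := by
    intro ε hε t ht
    rw [kropinaDenom, feffermanMetric_circleField g (hΓ.mem ε hε t ht), hφ]
  have hL : ∀ ε ∈ Ioo (-δ) δ, ∀ t ∈ Icc a b, kropinaIntegrand g a b (Γ ε) t =
      2 * (φ 0 (ε, t) * κ 1 2 (ε, t) + φ 1 (ε, t) * κ 2 0 (ε, t)
        + φ 2 (ε, t) * κ 0 1 (ε, t)) / φ 2 (ε, t) := by
    intro ε hε t ht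
    rw [kropinaIntegrand, hden ε hε t ht]
    congr 1
    simp only [feffermanMetric, connectionComp, Fin.sum_univ_three, hφ, hκ, Matrix.cons_val]
    ring
  have hΓ0 : MDifferentiableOn 𝓘(ℝ, ℝ) (tripleModel E) (Γ 0) (Icc a b) :=
    (hγ.congr hΓ.zero).mdifferentiableOn (by simp)
  have hlift : ∀ t ∈ Icc a b, ∃ f : ℝ, f ≠ 0 ∧
      (projDeriv (Γ 0 t) (frameVelocity a b (Γ 0) t) : E) = f • (frameVec (Γ 0 t) 2 : E) :=
    fun t ht => exists_projDeriv_frameVelocity_eq g hab hx hΓ0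
      (fun s hs => by rw [hΓ.zero s hs, hγx s hs]) ht
  have hne0 : ∀ t ∈ Icc a b, φ 2 (0, t) ≠ 0 := by
    intro t ht
    obtain ⟨f, hf, hT⟩ := hlift t ht
    rw [hφ, canonicalForm_two_of_projDeriv_eq g (hΓ.mem 0 h0δ t ht) hT]
    exact hf
  -- The repeated membership makes the claim vacuous for times outside `[a, b]`, so it can hold on
  -- full neighbourhoods of `(0, t)`, as the compactness argument requires.
  have hne : ∀ᶠ ε in 𝓝 (0 : ℝ), ∀ t ∈ Icc a b, t ∈ Icc a b → φ 2 (ε, t) ≠ 0 := by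
    refine isCompact_Icc.eventually_forall_of_forall_eventually fun t ht => ?_
    have h1 := ((hφs 2).continuousOn (0, t) ⟨h0δ, ht⟩).eventually_ne (hne0 t ht)
    rw [eventually_nhdsWithin_iff] at h1
    have h2 : ∀ᶠ p : ℝ × ℝ in 𝓝 (0, t), p.1 ∈ Ioo (-δ) δ :=
      continuousAt_fst.eventually (isOpen_Ioo.mem_nhds h0δ)
    filter_upwards [h1, h2] with p hp1 hp2 hp3
    exact hp1 ⟨hp2, hp3⟩
  obtain ⟨η₀, hη₀, hball⟩ := Metric.eventually_nhds_iff.1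
    (hne.and (isOpen_Ioo.mem_nhds h0δ : ∀ᶠ ε in 𝓝 (0 : ℝ), ε ∈ Ioo (-δ) δ))
  -- Halving the radius gives a closed interval, hence a compact rectangle on which the integrand is
  -- C¹.
  have hη : 0 < η₀ / 2 := by linarith
  have hgood : ∀ ε ∈ Icc (-(η₀ / 2)) (η₀ / 2), ε ∈ Ioo (-δ) δ ∧ ∀ t ∈ Icc a b, φ 2 (ε, t) ≠ 0 := by
    intro ε hε
    have h := @hball ε (by
      rw [Real.dist_0_eq_abs, abs_lt]
      constructor <;> linarith [hε.1, hε.2])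
    exact ⟨h.2, fun t ht => h.1 t ht ht⟩
  have hI : Icc (-(η₀ / 2)) (η₀ / 2) ∈ 𝓝 (0 : ℝ) := Icc_mem_nhds (by linarith) hη
  have hLs : ContDiffOn ℝ 1 (fun p : ℝ × ℝ => kropinaIntegrand g a b (Γ p.1) p.2)
      (Icc (-(η₀ / 2)) (η₀ / 2) ×ˢ Icc a b) := by
    have hsub : Icc (-(η₀ / 2)) (η₀ / 2) ×ˢ Icc a b ⊆ Ioo (-δ) δ ×ˢ Icc a b :=
      prod_mono_left fun ε hε => (hgood ε hε).1
    have h := ContDiffOn.div (contDiffOn_const (c := (2 : ℝ)).mul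
      ((((hφs 0).mul (hκs 1 2)).add ((hφs 1).mul (hκs 2 0))).add ((hφs 2).mul (hκs 0 1)))
        |>.mono hsub) ((hφs 2).mono hsub) fun p hp => (hgood p.1 hp.1).2 p.2 hp.2
    exact h.congr fun p hp => hL p.1 (hgood p.1 hp.1).1 p.2 hp.2
  -- At a fixed endpoint the variation is constant in ε, so its field vanishes there.
  have hend : ∀ t ∈ Icc a b, (∀ ε ∈ Ioo (-δ) δ, Γ ε t = γ t) →
      connectionForm g (Γ 0 t) (variationField Γ t) 0 1 = 0 := by
    intro t ht hc
    have h1 : (fun ε => Γ ε t) =ᶠ[𝓝 0] fun _ => γ t := by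
      filter_upwards [isOpen_Ioo.mem_nhds h0δ] with ε hε using hc ε hε
    have h2 : variationField Γ t = 0 := by
      have h3 := h1.mfderiv_eq (I := 𝓘(ℝ, ℝ)) (I' := tripleModel E)
      rw [mfderiv_const] at h3
      exact DFunLike.congr_fun h3 (1 : ℝ)
    rw [h2, connectionForm_zero]
  refine ⟨?_, ?_⟩
  · filter_upwards [hI] with ε hε
    refine ⟨fun t ht => ?_, ?_⟩
    · rw [hden ε (hgood ε hε).1 t ht]
      exact (hgood ε hε).2 t ht
    · have hc : ContinuousOn (kropinaIntegrand g a b (Γ ε)) (Icc a b) :=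
        hLs.continuousOn.comp (f := fun t => (ε, t)) (by fun_prop) fun t ht => ⟨hε, ht⟩
      exact (hc.mono (by rw [uIcc_of_le hab.le])).intervalIntegrable
  · refine hasDerivAt_integral_of_variation_eq_deriv hab hη hLs
      (continuousOn_connectionForm_variationField g hδ hab hsm 0 1)
      (hend a (left_mem_Icc.2 hab.le) hΓ.left) (hend b (right_mem_Icc.2 hab.le) hΓ.right) ?_
    intro t ht
    obtain ⟨f, hf, hT⟩ := hlift t (Ioo_subset_Icc_self ht)
    obtain ⟨c, h1, h2⟩ := exists_hasDerivAt_variation hE hδ hab hΓ hvert ht hf hT hφ hκ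
    refine ⟨c, h1.congr_of_eventuallyEq ?_, h2⟩
    filter_upwards [isOpen_Ioo.mem_nhds h0δ] with ε hε
    exact hL ε hε t (Ioo_subset_Icc_self ht)
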